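/- Let $G=(V,E)$ be a finite, simple, undirected graph and let $\mathcal G$ be a finite abelian group. Call $G$ \emph{zero-forcing for $\mathcal G$} if for every map $\ell : V \to \mathcal G$ there is a non-empty set $A \subseteq V$ such that the induced subgraph $G[A]$ is connected and $\sum_{a\in A}\ell(a) = 0$. Let $D(\mathcal G)$ be the Davenport constant of $\mathcal G$, i.e. the least integer $n$ such that for all $g_1,\dots,g_n\in\mathcal G$ there is a non-empty $I\subseteq\{1,\dots,n\}$ with $\sum_{i\in I} g_i = 0$. Let $d(G) = \frac{1}{|V|}\sum_{v\in V}\deg(v)$ denote the average degree of $G$ (with $d(G)=0$ if $V=\emptyset$) and $\mathrm{tw}(G)$ its tree-width (with any convention of value at most $0$ if $V=\emptyset$). Suppose that $D(\mathcal G) > 2$. (a) If $d(G) \geq 2D(\mathcal G) - 4$, then $G$ is zero-forcing for $\mathcal G$. (b) If $\mathrm{tw}(G) \geq \min\{\,|\mathcal G| - 1,\; D(\mathcal G)^2 - D(\mathcal G) - 1\,\}$, then $G$ is zero-forcing for $\mathcal G$. -/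

import Mathlib

namespace ZeroForcing

/-- A labeling `ℓ` of the vertices is zero-avoiding if every non-empty connected set of vertices
(that is, a set inducing a connected subgraph) has non-zero sum of labels. -/
def IsZeroAvoiding {V 𝒢 : Type*} [AddCommGroup 𝒢] (G : SimpleGraph V) (ℓ : V → 𝒢) : Prop :=
  ∀ A : Finset V, A.Nonempty → (G.induce (A : Set V)).Connected → ∑ a ∈ A, ℓ a ≠ 0

/-- `G` is zero-forcing for `𝒢` if no `𝒢`-labeling of `G` is zero-avoiding. -/
def IsZeroForcing {V : Type*} (G : SimpleGraph V) (𝒢 : Type*) [AddCommGroup 𝒢] : Prop :=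
  ¬ ∃ ℓ : V → 𝒢, IsZeroAvoiding G ℓ

/-- The Davenport constant: the least `n` such that every family of `n` elements of `𝒢` indexed by
an `n`-element set has a non-empty subfamily with sum zero. -/
noncomputable def davenport (𝒢 : Type*) [AddCommGroup 𝒢] : ℕ :=
  sInf {n : ℕ | ∀ f : Fin n → 𝒢, ∃ s : Finset (Fin n), s.Nonempty ∧ ∑ i ∈ s, f i = 0}

/-- The average degree of a finite graph. -/
def averageDegree {V : Type*} [Fintype V] (G : SimpleGraph V) [DecidableRel G.Adj] : ℚ :=
  (∑ v, (G.degree v : ℚ)) / (Fintype.card V : ℚ)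

/-- `(T, bag)` is a tree-decomposition of `G`. -/
structure IsTreeDecomposition {V ι : Type*} (G : SimpleGraph V) (T : SimpleGraph ι)
    (bag : ι → Finset V) : Prop where
  isTree : T.IsTree
  vertex_mem : ∀ v, ∃ t, v ∈ bag t
  edge_mem : ∀ u v, G.Adj u v → ∃ t, u ∈ bag t ∧ v ∈ bag t
  connected : ∀ v, (T.induce {t | v ∈ bag t}).Connected

/-- The tree-width of a finite graph: the least `w` such that `G` has a tree-decomposition over a
finite tree all of whose bags have at most `w + 1` vertices.  (The graph without vertices gets the
value `0`.) -/
noncomputable def treewidth {V : Type*} (G : SimpleGraph V) : ℕ :=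
  sInf {w : ℕ | ∃ (n : ℕ) (T : SimpleGraph (Fin n)) (bag : Fin n → Finset V),
    IsTreeDecomposition G T bag ∧ ∀ t, (bag t).card ≤ w + 1}

end ZeroForcing

/-!
Call a labelling zero-avoiding if no non-empty connected set has label sum zero, and put
`D = davenport 𝒢`. If `C` is connected in a zero-avoiding graph and no non-empty set of boundary
vertices of `C` has sum zero, then the label of `C` and the labels of its boundary vertices form a
zero-sum-free family, so `C` has at most `D - 2` boundary vertices. This is the only way in which
the Davenport constant enters. It yields `not_isZeroAvoiding_of_inseparable`: a zero-avoiding graph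
does not have `D` disjoint connected sets no two of which are separated by `D - 2` vertices. Among
such sets some would have total sum zero; enlarging them by zero-sum boundary sets and merging them
when they touch produces a connected zero-sum set, unless the process stops with a boundary of at
most `D - 2` vertices that separates two of the given sets.

Density. In a minimal counterexample, contracting an edge shows that the ends of every edge have
at least `D - 2` common neighbours, and deleting a vertex shows that no vertex is isolated. Take a
tree-decomposition whose multiset of bag sizes is minimal. No two subsets of one of its bags are
separated by fewer vertices than each of them has (`RootedDecomp.exists_lean`), since a closest
violating separation could be used to split the decomposition into one with smaller bags. Choose a
vertex `v` for which the highest bag containing it is as deep as possible. This bag contains the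
closed neighbourhood `Q` of `v`, and every vertex of `Q` has at least `D - 1` vertices of `Q` in
its closed neighbourhood. Hence `D - 2` vertices cannot separate two vertices of `Q`, and `Q` has
at least `D` elements.

Tree-width. By tree-width duality (`exists_decomp_of_bramble_cover`) a graph of tree-width at least
`w` has a bramble that is not covered by `w` vertices, and some path meets all members of this
bramble (`IsBramble.exists_path`). For `w = |𝒢| - 1` the path has at least `|𝒢|` vertices, so two of
its partial label sums agree and a segment has sum zero. For `w = D * (D - 1) - 1` the path can be
cut into `D` segments each of which meets a subfamily not covered by `D - 2` vertices
(`exists_segments`), and no two such segments are separated by `D - 2` vertices.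
-/

namespace ZeroForcing

/-! ### Connected sets and vertex boundaries -/

/-- The outer vertex boundary of `C`: the vertices outside `C` with a neighbour in `C`. -/
noncomputable def boundary {V : Type*} [Fintype V] (G : SimpleGraph V) (C : Finset V) : Finset V :=
  open scoped Classical in Finset.univ.filter fun v => v ∉ C ∧ ∃ u ∈ C, G.Adj u v

/-- `A` is non-empty and induces a connected subgraph, phrased through cuts: a set meeting `A` and
closed under passing to neighbours inside `A` contains `A`. -/
def IsConn {V : Type*} (G : SimpleGraph V) (A : Finset V) : Prop :=
  A.Nonempty ∧ ∀ Z : Set V, (∃ x ∈ A, x ∈ Z) →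
    (∀ u ∈ A, u ∈ Z → ∀ v ∈ A, G.Adj u v → v ∈ Z) → ∀ x ∈ A, x ∈ Z

section Conn

variable {V : Type*} {G : SimpleGraph V}

theorem mem_boundary [Fintype V] {C : Finset V} {v : V} :
    v ∈ boundary G C ↔ v ∉ C ∧ ∃ u ∈ C, G.Adj u v := by
  simp [boundary]

theorem IsConn.induce_connected {A : Finset V} (h : IsConn G A) :
    (G.induce (A : Set V)).Connected := by
  obtain ⟨⟨a, ha⟩, hcut⟩ := h
  have key : ∀ x ∈ A, x ∈ {x | ∃ hx : x ∈ (A : Set V),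
      (G.induce (A : Set V)).Reachable ⟨a, ha⟩ ⟨x, hx⟩} := by
    refine hcut _ ⟨a, ha, ha, SimpleGraph.Reachable.refl _⟩ ?_
    rintro u hu ⟨hu', hr⟩ v hv huv
    refine ⟨hv, hr.trans (SimpleGraph.Adj.reachable ?_)⟩
    simpa using huv
  have : Nonempty (A : Set V) := ⟨⟨a, ha⟩⟩
  refine SimpleGraph.Connected.mk ?_
  rintro ⟨x, hx⟩ ⟨y, hy⟩
  obtain ⟨_, hx'⟩ := key x hx
  obtain ⟨_, hy'⟩ := key y hy
  exact hx'.symm.trans hy'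

theorem isConn_singleton (v : V) : IsConn G {v} := by
  refine ⟨⟨v, by simp⟩, ?_⟩
  rintro Z ⟨x, hx, hxZ⟩ - y hy
  simp only [Finset.mem_singleton] at hx hy
  subst hx hy
  exact hxZ

theorem IsConn.union [DecidableEq V] {A B : Finset V} (hA : IsConn G A) (hB : IsConn G B)
    (h : ∃ a ∈ A, ∃ b ∈ B, a = b ∨ G.Adj a b) : IsConn G (A ∪ B) := by
  obtain ⟨a, ha, b, hb, hab⟩ := h
  refine ⟨⟨a, by simp [ha]⟩, ?_⟩
  rintro Z ⟨x, hx, hxZ⟩ hZ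
  have hAZ : (∃ x ∈ A, x ∈ Z) → ∀ x ∈ A, x ∈ Z := fun h => hA.2 Z h fun u hu huZ v hv huv =>
    hZ u (by simp [hu]) huZ v (by simp [hv]) huv
  have hBZ : (∃ x ∈ B, x ∈ Z) → ∀ x ∈ B, x ∈ Z := fun h => hB.2 Z h fun u hu huZ v hv huv =>
    hZ u (by simp [hu]) huZ v (by simp [hv]) huv
  have hABZ : a ∈ Z ↔ b ∈ Z := by
    rcases hab with rfl | hab
    · rfl
    · exact ⟨fun h => hZ a (by simp [ha]) h b (by simp [hb]) hab,
        fun h => hZ b (by simp [hb]) h a (by simp [ha]) hab.symm⟩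
  have hboth : (∀ x ∈ A, x ∈ Z) ∧ ∀ x ∈ B, x ∈ Z := by
    rcases Finset.mem_union.1 hx with hx | hx
    · have := hAZ ⟨x, hx, hxZ⟩
      exact ⟨this, hBZ ⟨b, hb, hABZ.1 (this a ha)⟩⟩
    · have := hBZ ⟨x, hx, hxZ⟩
      exact ⟨hAZ ⟨a, ha, hABZ.2 (this b hb)⟩, this⟩
  intro y hy
  rcases Finset.mem_union.1 hy with hy | hy
  · exact hboth.1 y hy
  · exact hboth.2 y hy

theorem IsConn.union_subset_boundary [Fintype V] [DecidableEq V] {A W : Finset V}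
    (hA : IsConn G A) (hW : W ⊆ boundary G A) : IsConn G (A ∪ W) := by
  induction W using Finset.induction_on with
  | empty => simpa using hA
  | insert w W _ ih =>
    have hw := mem_boundary.1 (hW (Finset.mem_insert_self w W))
    obtain ⟨-, u, hu, huw⟩ := hw
    have := (ih ((Finset.subset_insert w W).trans hW)).union (isConn_singleton w)
      ⟨u, by simp [hu], w, by simp, Or.inr huw⟩
    convert this using 1
    ext x; simp only [Finset.mem_union, Finset.mem_insert, Finset.mem_singleton]; tauto

/-- A connected set that meets `C` and avoids the boundary of `C` lies in `C`. -/
theorem IsConn.subset_of_disjoint_boundary [Fintype V] {B C : Finset V} (hB : IsConn G B)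
    (hBC : ∃ x ∈ B, x ∈ C) (h : Disjoint B (boundary G C)) : B ⊆ C := by
  refine hB.2 (C : Set V) hBC ?_
  intro u hu huC v hv huv
  by_contra hvC
  exact Finset.disjoint_left.1 h hv (mem_boundary.2 ⟨hvC, u, huC, huv⟩)

/-- A maximal connected subset of `Y` has no boundary inside `Y`. -/
theorem exists_isConn_boundary_disjoint [Fintype V] [DecidableEq V] {Y : Finset V} {v : V}
    (hv : v ∈ Y) : ∃ C ⊆ Y, v ∈ C ∧ IsConn G C ∧ Disjoint Y (boundary G C) := by
  classical
  obtain ⟨C, hC, hmax⟩ := Finset.exists_max_image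
    (Y.powerset.filter fun C => v ∈ C ∧ IsConn G C) Finset.card
    ⟨{v}, by simp [hv, isConn_singleton]⟩
  simp only [Finset.mem_filter, Finset.mem_powerset] at hC hmax
  refine ⟨C, hC.1, hC.2.1, hC.2.2, Finset.disjoint_left.2 fun w hwY hw => ?_⟩
  have h1 := hC.2.2.union_subset_boundary (W := {w}) (by simpa using hw)
  have h2 := hmax (C ∪ {w}) ⟨Finset.union_subset hC.1 (by simpa using hwY),
    Finset.mem_union_left _ hC.2.1, h1⟩
  rw [Finset.card_union_of_disjoint (by simpa using (mem_boundary.1 hw).1)] at h2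
  simp at h2

end Conn

/-! ### Zero-sum-free families -/

/-- A family of at least `davenport 𝒢` elements has a non-empty zero-sum subfamily, provided that
the defining set of the Davenport constant is non-empty. -/
theorem exists_zero_sum_of_davenport_le {𝒢 : Type*} [AddCommGroup 𝒢] (hD : 0 < davenport 𝒢)
    {α : Type*} (s : Finset α) (f : α → 𝒢) (hs : davenport 𝒢 ≤ s.card) :
    ∃ t ⊆ s, t.Nonempty ∧ ∑ i ∈ t, f i = 0 := by
  classical
  have hmem : davenport 𝒢 ∈ {n : ℕ | ∀ f : Fin n → 𝒢, ∃ s : Finset (Fin n), s.Nonempty ∧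
      ∑ i ∈ s, f i = 0} := Nat.sInf_mem (Nat.nonempty_of_pos_sInf hD)
  obtain ⟨s', hs's, hs'⟩ := Finset.exists_subset_card_eq hs
  let e : Fin (davenport 𝒢) ≃ s' := (Finset.equivFinOfCardEq hs').symm
  obtain ⟨t, htne, ht⟩ := hmem fun i => f (e i)
  refine ⟨t.map (e.toEmbedding.trans (Function.Embedding.subtype _)), ?_, by simpa using htne, ?_⟩
  · intro x hx
    simp only [Finset.mem_map] at hx
    obtain ⟨i, -, rfl⟩ := hx
    exact hs's (e i).2
  · simpa [Finset.sum_map] using ht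

/-- A boundary with at least `davenport 𝒢 - 1` vertices contains a zero-sum set: a zero-sum
subfamily of the labels on the boundary and the label of `C` cannot use the latter, as it would
form a connected zero-sum set. -/
theorem exists_zero_sum_subset_boundary {V 𝒢 : Type*} [Fintype V] [DecidableEq V] [AddCommGroup 𝒢]
    (hD : 0 < davenport 𝒢) {G : SimpleGraph V} {ℓ : V → 𝒢} (hℓ : IsZeroAvoiding G ℓ)
    {C : Finset V} (hC : IsConn G C) (hcard : davenport 𝒢 ≤ (boundary G C).card + 1) :
    ∃ W ⊆ boundary G C, W.Nonempty ∧ ∑ w ∈ W, ℓ w = 0 := by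
  obtain ⟨t, hts, htne, ht⟩ := exists_zero_sum_of_davenport_le hD
    (Finset.insertNone (boundary G C)) (fun o => o.elim (∑ c ∈ C, ℓ c) ℓ)
    (by rwa [Finset.card_insertNone])
  have hW : Finset.eraseNone t ⊆ boundary G C := by
    intro w hw
    have := hts (Finset.mem_eraseNone.1 hw)
    simpa using this
  by_cases hnone : none ∈ t
  · exfalso
    have ht' : t = Finset.insertNone (Finset.eraseNone t) := by
      rw [Finset.insertNone_eraseNone, Finset.insert_eq_of_mem hnone]
    rw [ht', Finset.sum_insertNone] at ht
    have hdisj : Disjoint C (Finset.eraseNone t) :=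
      Finset.disjoint_right.2 fun w hw => (mem_boundary.1 (hW hw)).1
    have hconn := hC.union_subset_boundary hW
    refine hℓ _ hconn.1 hconn.induce_connected ?_
    rw [Finset.sum_union hdisj]
    simpa using ht
  · have ht' : t = (Finset.eraseNone t).map Function.Embedding.some := by
      rw [Finset.map_some_eraseNone, Finset.erase_eq_of_notMem hnone]
    refine ⟨Finset.eraseNone t, hW, ?_, ?_⟩
    · rw [ht'] at htne
      exact Finset.map_nonempty.1 htne
    · rw [ht', Finset.sum_map] at ht
      simpa using ht

/-- If `davenport 𝒢` disjoint connected sets are such that no two of them can be separated by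
at most `davenport 𝒢 - 2` vertices, then no labelling is zero-avoiding. -/
theorem not_isZeroAvoiding_of_inseparable {V 𝒢 : Type*} [Fintype V] [DecidableEq V]
    [AddCommGroup 𝒢] (hD : 0 < davenport 𝒢) {G : SimpleGraph V} {ℓ : V → 𝒢}
    (A : Fin (davenport 𝒢) → Finset V) (hconn : ∀ i, IsConn G (A i))
    (hdisj : ∀ i j, i ≠ j → Disjoint (A i) (A j))
    (hinsep : ∀ i j, i ≠ j → ∀ C : Finset V, A i ⊆ C → Disjoint (A j) (C ∪ boundary G C) →
      davenport 𝒢 ≤ (boundary G C).card + 1) :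
    ¬ IsZeroAvoiding G ℓ := by
  intro hℓ
  -- A zero-sum union of disjoint connected sets `C i ⊇ A i` is modified so that first the number
  -- of parts and then the number of uncovered vertices drops.
  have key : ∀ m : ℕ, ∀ (I : Finset (Fin (davenport 𝒢))) (C : Fin (davenport 𝒢) → Finset V),
      I.card * (Fintype.card V + 1) + (Fintype.card V - (I.biUnion C).card) = m →
      I.Nonempty → (∀ i ∈ I, A i ⊆ C i ∧ IsConn G (C i)) →
      (∀ i ∈ I, ∀ j ∈ I, i ≠ j → Disjoint (C i) (C j)) →
      ∑ i ∈ I, ∑ v ∈ C i, ℓ v = 0 → False := by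
    intro m
    induction m using Nat.strong_induction_on with
    | _ m ih =>
    intro I C hm hI hC hCd hsum
    obtain ⟨i, hi⟩ := hI
    by_cases hone : ∀ j ∈ I, j = i
    · have hIi : I = {i} := by
        ext j; simp only [Finset.mem_singleton]
        exact ⟨hone j, fun h => h ▸ hi⟩
      rw [hIi, Finset.sum_singleton] at hsum
      exact hℓ _ (hC i hi).2.1 (hC i hi).2.induce_connected hsum
    push Not at hone
    obtain ⟨j₀, hj₀, hj₀i⟩ := hone
    by_cases hmeet : ∃ j ∈ I, j ≠ i ∧ ∃ w ∈ C j, w ∈ boundary G (C i)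
    · obtain ⟨j, hj, hji, w, hwj, hw⟩ := hmeet
      obtain ⟨-, u, hu, huw⟩ := mem_boundary.1 hw
      refine ih _ ?_ (I.erase j) (Function.update C i (C i ∪ C j)) rfl
        ⟨i, by simp [hi, hji.symm]⟩ ?_ ?_ ?_
      · have h1 : (I.erase j).card + 1 = I.card := Finset.card_erase_add_one hj
        rw [← hm, ← h1, add_mul]
        omega
      · intro k hk
        have hkI := Finset.mem_of_mem_erase hk
        by_cases hki : k = i
        · subst hki
          simp only [Function.update_self]
          exact ⟨(hC k hkI).1.trans Finset.subset_union_left,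
            (hC k hkI).2.union (hC j hj).2 ⟨u, hu, w, hwj, Or.inr huw⟩⟩
        · simpa only [Function.update_of_ne hki] using hC k hkI
      · intro k hk l hl hkl
        obtain ⟨hkj, hkI⟩ := Finset.mem_erase.1 hk
        obtain ⟨hlj, hlI⟩ := Finset.mem_erase.1 hl
        by_cases hki : k = i
        · subst hki
          rw [Function.update_self, Function.update_of_ne hkl.symm]
          exact Finset.disjoint_union_left.2 ⟨hCd k hkI l hlI hkl, hCd j hj l hlI hlj.symm⟩
        · by_cases hli : l = i
          · subst hli
            rw [Function.update_self, Function.update_of_ne hki]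
            exact Finset.disjoint_union_right.2 ⟨hCd k hkI l hlI hkl, hCd k hkI j hj hkj⟩
          · rw [Function.update_of_ne hki, Function.update_of_ne hli]
            exact hCd k hkI l hlI hkl
      · have hie : i ∈ I.erase j := by simp [hi, hji.symm]
        rw [← Finset.add_sum_erase _ _ hj, ← Finset.add_sum_erase _ _ hie] at hsum
        rw [← Finset.add_sum_erase _ _ hie, Function.update_self,
          Finset.sum_union (hCd i hi j hj hji.symm)]
        rw [Finset.sum_congr rfl (g := fun k => ∑ v ∈ C k, ℓ v)]
        · rw [← hsum]; abel
        · intro k hk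
          rw [Function.update_of_ne (Finset.ne_of_mem_erase hk)]
    push Not at hmeet
    have hcard := hinsep i j₀ hj₀i.symm (C i) (hC i hi).1 (by
      refine Finset.disjoint_left.2 fun w hw hw' => ?_
      have hwC := (hC j₀ hj₀).1 hw
      rcases Finset.mem_union.1 hw' with hw' | hw'
      · exact Finset.disjoint_left.1 (hCd i hi j₀ hj₀ hj₀i.symm) hw' hwC
      · exact hmeet j₀ hj₀ hj₀i w hwC hw')
    obtain ⟨W, hW, hWne, hWsum⟩ := exists_zero_sum_subset_boundary hD hℓ (hC i hi).2 hcard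
    have hCW : ∀ j ∈ I, Disjoint (C j) W := fun j hj => by
      by_cases hji : j = i
      · subst hji
        exact Finset.disjoint_right.2 fun w hw => (mem_boundary.1 (hW hw)).1
      · exact Finset.disjoint_left.2 fun w hwC hw => hmeet j hj hji w hwC (hW hw)
    have hupd : ∀ k ∈ I.erase i, Function.update C i (C i ∪ W) k = C k := fun k hk =>
      Function.update_of_ne (Finset.ne_of_mem_erase hk) _ _
    refine ih _ ?_ I (Function.update C i (C i ∪ W)) rfl ⟨i, hi⟩ ?_ ?_ ?_
    · have hlt : (I.biUnion C).card < (I.biUnion (Function.update C i (C i ∪ W))).card := by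
        apply Finset.card_lt_card
        refine Finset.ssubset_iff_of_subset ?_ |>.2 ?_
        · intro x hx
          obtain ⟨k, hk, hxk⟩ := Finset.mem_biUnion.1 hx
          refine Finset.mem_biUnion.2 ⟨k, hk, ?_⟩
          by_cases hki : k = i
          · subst hki; simp [hxk]
          · rwa [Function.update_of_ne hki]
        · obtain ⟨w, hw⟩ := hWne
          refine ⟨w, Finset.mem_biUnion.2 ⟨i, hi, by simp [hw]⟩, fun hw' => ?_⟩
          obtain ⟨k, hk, hwk⟩ := Finset.mem_biUnion.1 hw'
          exact Finset.disjoint_left.1 (hCW k hk) hwk hw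
      have hle : (I.biUnion (Function.update C i (C i ∪ W))).card ≤ Fintype.card V :=
        Finset.card_le_univ _
      omega
    · intro k hk
      by_cases hki : k = i
      · subst hki
        rw [Function.update_self]
        exact ⟨(hC k hk).1.trans Finset.subset_union_left,
          (hC k hk).2.union_subset_boundary hW⟩
      · simpa only [Function.update_of_ne hki] using hC k hk
    · intro k hk l hl hkl
      by_cases hki : k = i
      · subst hki
        rw [Function.update_self, Function.update_of_ne hkl.symm]
        exact Finset.disjoint_union_left.2 ⟨hCd k hk l hl hkl, (hCW l hl).symm⟩
      · by_cases hli : l = i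
        · subst hli
          rw [Function.update_self, Function.update_of_ne hki]
          exact Finset.disjoint_union_right.2 ⟨hCd k hk l hl hkl, hCW k hk⟩
        · rw [Function.update_of_ne hki, Function.update_of_ne hli]
          exact hCd k hk l hl hkl
    · rw [← Finset.add_sum_erase _ _ hi] at hsum
      have hrest : ∑ k ∈ I.erase i, ∑ v ∈ Function.update C i (C i ∪ W) k, ℓ v =
          ∑ k ∈ I.erase i, ∑ v ∈ C k, ℓ v := Finset.sum_congr rfl fun k hk => by rw [hupd k hk]
      rw [← Finset.add_sum_erase _ _ hi, Function.update_self, Finset.sum_union (hCW i hi), hWsum,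
        add_zero, hrest]
      exact hsum
  obtain ⟨I, -, hIne, hI⟩ := exists_zero_sum_of_davenport_le hD Finset.univ
    (fun i => ∑ v ∈ A i, ℓ v) (by simp)
  exact key _ I A rfl hIne (fun i _ => ⟨subset_rfl, hconn i⟩)
    (fun i _ j _ hij => hdisj i j hij) hI

/-! ### Rooted tree-decompositions -/

/-- A rooted tree-decomposition of the subgraph of `G` induced by `K`. The tree on `ι` is given by
its parent function, whose acyclicity is witnessed by `depth` (which need not vanish at the root),
and the root is its own parent. The nodes whose bags contain `x` form a subtree: each of them
other than its highest node `top x` has a parent of the same kind. -/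
structure RootedDecomp {V : Type*} (G : SimpleGraph V) (K : Finset V) (ι : Type) where
  /-- The root of the tree. -/
  root : ι
  /-- The parent function of the tree. -/
  par : ι → ι
  /-- A rank function that decreases towards the root. -/
  depth : ι → ℕ
  /-- The bags. -/
  bag : ι → Finset V
  /-- The highest node whose bag contains a given vertex. -/
  top : V → ι
  par_root : par root = root
  depth_par : ∀ s, s ≠ root → depth (par s) < depth s
  bag_sub : ∀ s, bag s ⊆ K
  top_mem : ∀ x ∈ K, x ∈ bag (top x)
  up : ∀ x s, x ∈ bag s → s ≠ top x → s ≠ root ∧ x ∈ bag (par s)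
  edge : ∀ x ∈ K, ∀ y ∈ K, G.Adj x y → ∃ s, x ∈ bag s ∧ y ∈ bag s

namespace RootedDecomp

variable {V : Type*} {G : SimpleGraph V} {K : Finset V} {ι : Type}

/-- `s` is an ancestor of `t`; every node is an ancestor of itself. -/
def Anc (D : RootedDecomp G K ι) (s t : ι) : Prop := ∃ n : ℕ, D.par^[n] t = s

theorem Anc.refl (D : RootedDecomp G K ι) (s : ι) : D.Anc s s := ⟨0, rfl⟩

theorem Anc.trans {D : RootedDecomp G K ι} {r s t : ι} (h : D.Anc r s) (h' : D.Anc s t) :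
    D.Anc r t := by
  obtain ⟨n, rfl⟩ := h'
  obtain ⟨m, rfl⟩ := h
  exact ⟨m + n, by rw [Function.iterate_add_apply]⟩

theorem anc_par (D : RootedDecomp G K ι) (s : ι) : D.Anc (D.par s) s := ⟨1, rfl⟩

theorem depth_par_le (D : RootedDecomp G K ι) (s : ι) : D.depth (D.par s) ≤ D.depth s := by
  by_cases h : s = D.root
  · rw [h, D.par_root]
  · exact (D.depth_par s h).le

theorem Anc.depth_le {D : RootedDecomp G K ι} {s t : ι} (h : D.Anc s t) :
    D.depth s ≤ D.depth t := by
  obtain ⟨n, rfl⟩ := h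
  induction n with
  | zero => rfl
  | succ n ih =>
    rw [Function.iterate_succ_apply']
    exact (D.depth_par_le _).trans ih

theorem Anc.par_of_ne {D : RootedDecomp G K ι} {s t : ι} (h : D.Anc s t) (hne : s ≠ t) :
    D.Anc s (D.par t) := by
  obtain ⟨n, hn⟩ := h
  cases n with
  | zero => exact absurd hn.symm hne
  | succ n => exact ⟨n, by rwa [Function.iterate_succ_apply] at hn⟩

theorem Anc.depth_lt {D : RootedDecomp G K ι} {s t : ι} (h : D.Anc s t) (hne : s ≠ t) :
    D.depth s < D.depth t := by
  by_cases ht : t = D.root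
  · subst ht
    obtain ⟨n, hn⟩ := h
    exact absurd (hn.symm.trans (Function.iterate_fixed D.par_root n)) hne
  · exact (h.par_of_ne hne).depth_le.trans_lt (D.depth_par t ht)

theorem anc_root (D : RootedDecomp G K ι) (t : ι) : D.Anc D.root t := by
  induction h : D.depth t using Nat.strong_induction_on generalizing t with
  | _ m ih =>
    by_cases ht : t = D.root
    · rw [ht]; exact Anc.refl D _
    · exact (ih _ (h ▸ D.depth_par t ht) (D.par t) rfl).trans (D.anc_par t)

theorem eq_root_of_anc {D : RootedDecomp G K ι} {t : ι} (h : D.Anc t D.root) : t = D.root := by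
  obtain ⟨n, hn⟩ := h
  exact hn.symm.trans (Function.iterate_fixed D.par_root n)

theorem top_anc (D : RootedDecomp G K ι) {x : V} {s : ι} (hx : x ∈ D.bag s) :
    D.Anc (D.top x) s := by
  induction h : D.depth s using Nat.strong_induction_on generalizing s with
  | _ m ih =>
    by_cases hs : s = D.top x
    · rw [hs]; exact Anc.refl D _
    · obtain ⟨h1, h2⟩ := D.up x s hx hs
      exact (ih _ (h ▸ D.depth_par s h1) h2 rfl).trans (D.anc_par s)

theorem top_eq_root (D : RootedDecomp G K ι) {x : V} (hx : x ∈ D.bag D.root) :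
    D.top x = D.root := by
  by_contra h
  exact (D.up x _ hx (Ne.symm h)).1 rfl

/-- The bags on the tree path from a node containing `y` up to `top y` contain `y`. -/
theorem anc_top_or_mem (D : RootedDecomp G K ι) {y : V} {s r : ι} (hy : y ∈ D.bag r)
    (hsr : D.Anc s r) : D.Anc s (D.top y) ∨ y ∈ D.bag s := by
  obtain ⟨n, hn⟩ := hsr
  induction n generalizing r with
  | zero => exact Or.inr (by simpa [← hn] using hy)
  | succ n ih =>
    by_cases hr : r = D.top y
    · exact Or.inl ⟨n + 1, hr ▸ hn⟩
    · exact ih (D.up y r hy hr).2 (by rwa [Function.iterate_succ_apply] at hn)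

/-- The vertices of `K` that live strictly below the node `s`. -/
noncomputable def below (D : RootedDecomp G K ι) (s : ι) : Finset V :=
  open scoped Classical in K.filter fun x => x ∉ D.bag s ∧ D.Anc s (D.top x)

theorem mem_below {D : RootedDecomp G K ι} {s : ι} {x : V} :
    x ∈ D.below s ↔ x ∈ K ∧ x ∉ D.bag s ∧ D.Anc s (D.top x) := by
  simp [below]

/-- A bag separates the vertices below it from the rest. -/
theorem mem_bag_of_adj_below (D : RootedDecomp G K ι) {s : ι} {x y : V} (hx : x ∈ D.below s)
    (hyK : y ∈ K) (hxy : G.Adj x y) (hy : y ∉ D.below s) : y ∈ D.bag s := by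
  obtain ⟨hxK, -, hs⟩ := mem_below.1 hx
  obtain ⟨r, hxr, hyr⟩ := D.edge x hxK y hyK hxy
  by_contra hys
  rcases D.anc_top_or_mem hyr (hs.trans (D.top_anc hxr)) with h | h
  · exact hy (mem_below.2 ⟨hyK, hys, h⟩)
  · exact hys h

theorem depth_lt_of_mem_below (D : RootedDecomp G K ι) {s : ι} {x : V} (hx : x ∈ D.below s) :
    D.depth s < D.depth (D.top x) := by
  obtain ⟨hxK, hxs, hs⟩ := mem_below.1 hx
  refine hs.depth_lt fun h => hxs ?_
  rw [h]; exact D.top_mem x hxK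

theorem notMem_below_of_mem_root (D : RootedDecomp G K ι) {s : ι} {x : V}
    (hx : x ∈ D.bag D.root) : x ∉ D.below s := by
  intro h
  obtain ⟨-, hxs, hs⟩ := mem_below.1 h
  rw [D.top_eq_root hx] at hs
  rw [eq_root_of_anc hs] at hxs
  exact hxs hx

theorem exists_cast {K' : Finset V} (h : K = K')
    (D : RootedDecomp G K ι) :
    ∃ D' : RootedDecomp G K' ι, D'.bag = D.bag ∧ D'.root = D.root := by
  subst h; exact ⟨D, rfl, rfl⟩

/-- The decomposition with a single bag. -/
def single (G : SimpleGraph V) (K : Finset V) : RootedDecomp G K Unit where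
  root := ()
  par := id
  depth _ := 0
  bag _ := K
  top _ := ()
  par_root := rfl
  depth_par _ hs := absurd rfl hs
  bag_sub _ := subset_rfl
  top_mem _ hx := hx
  up _ _ _ hs := absurd rfl hs
  edge _ hx _ hy _ := ⟨(), hx, hy⟩

/-- Two decompositions are glued by an edge between their roots, where the first root stays the
root. The common vertices have to lie in both root bags. -/
noncomputable def glue [DecidableEq V] {K₁ K₂ : Finset V} {ι₁ ι₂ : Type}
    (D₁ : RootedDecomp G K₁ ι₁) (D₂ : RootedDecomp G K₂ ι₂)
    (h₁ : K₁ ∩ K₂ ⊆ D₁.bag D₁.root) (h₂ : K₁ ∩ K₂ ⊆ D₂.bag D₂.root)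
    (hsep : ∀ x ∈ K₁, ∀ y ∈ K₂, G.Adj x y → x ∈ K₂ ∨ y ∈ K₁) :
    RootedDecomp G (K₁ ∪ K₂) (ι₁ ⊕ ι₂) where
  root := Sum.inl D₁.root
  par := Sum.elim (fun s => Sum.inl (D₁.par s)) (fun s => open scoped Classical in
    if s = D₂.root then Sum.inl D₁.root else Sum.inr (D₂.par s))
  depth := Sum.elim D₁.depth (fun s => D₂.depth s + D₁.depth D₁.root + 1)
  bag := Sum.elim D₁.bag D₂.bag
  top x := if x ∈ K₁ then Sum.inl (D₁.top x) else Sum.inr (D₂.top x)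
  par_root := by simp [D₁.par_root]
  depth_par := by
    rintro (s | s) hs
    · simpa using D₁.depth_par s (by simpa using hs)
    · by_cases h : s = D₂.root
      · simp only [Sum.elim_inr, h, if_true, Sum.elim_inl]; omega
      · have := D₂.depth_par s h
        simp only [Sum.elim_inr, h, if_false]; omega
  bag_sub := by
    rintro (s | s)
    · exact (D₁.bag_sub s).trans Finset.subset_union_left
    · exact (D₂.bag_sub s).trans Finset.subset_union_right
  top_mem := by
    intro x hx
    by_cases h : x ∈ K₁
    · simpa [h] using D₁.top_mem x h
    · simpa [h] using D₂.top_mem x (by simpa [h] using hx)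
  up := by
    rintro x (s | s) hx hs
    · have hxs : x ∈ D₁.bag s := hx
      have hxK := D₁.bag_sub s hxs
      simp only [hxK, if_true] at hs
      have := D₁.up x s hxs (by simpa using hs)
      simpa using this
    · have hxs : x ∈ D₂.bag s := hx
      have hxK := D₂.bag_sub s hxs
      refine ⟨by simp, ?_⟩
      by_cases h : x ∈ K₁
      · have h1 := h₁ (Finset.mem_inter.2 ⟨h, hxK⟩)
        have h2 := h₂ (Finset.mem_inter.2 ⟨h, hxK⟩)
        by_cases hr : s = D₂.root
        · simpa [hr] using h1
        · simpa [hr] using (D₂.up x s hxs (by rwa [D₂.top_eq_root h2])).2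
      · simp only [h, if_false] at hs
        have := D₂.up x s hxs (by simpa using hs)
        simpa [this.1] using this.2
  edge := by
    intro x hx y hy hxy
    have e₁ : x ∈ K₁ → y ∈ K₁ → ∃ s, x ∈ Sum.elim D₁.bag D₂.bag s ∧ y ∈ Sum.elim D₁.bag D₂.bag s :=
      fun hx hy => by
        obtain ⟨s, hs⟩ := D₁.edge x hx y hy hxy
        exact ⟨Sum.inl s, hs⟩
    have e₂ : x ∈ K₂ → y ∈ K₂ → ∃ s, x ∈ Sum.elim D₁.bag D₂.bag s ∧ y ∈ Sum.elim D₁.bag D₂.bag s :=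
      fun hx hy => by
        obtain ⟨s, hs⟩ := D₂.edge x hx y hy hxy
        exact ⟨Sum.inr s, hs⟩
    rcases Finset.mem_union.1 hx with hx₁ | hx₂ <;> rcases Finset.mem_union.1 hy with hy₁ | hy₂
    · exact e₁ hx₁ hy₁
    · rcases hsep x hx₁ y hy₂ hxy with h | h
      · exact e₂ h hy₂
      · exact e₁ hx₁ h
    · rcases hsep y hy₁ x hx₂ hxy.symm with h | h
      · exact e₂ hx₂ h
      · exact e₁ h hy₁
    · exact e₂ hx₂ hy₂

/-- The decomposition of `G[K']` obtained from one of `G[K]` by restricting all bags to `K'` and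
adding each `x ∈ X` to the bags on the path from the root to `top x`. -/
noncomputable def restrict [DecidableEq V] (D : RootedDecomp G K ι) {K' X : Finset V}
    (hK : K' ⊆ K) (hX : X ⊆ K') : RootedDecomp G K' ι where
  root := D.root
  par := D.par
  depth := D.depth
  bag s := (D.bag s ∩ K') ∪ (X ∩ D.below s)
  top x := if x ∈ X then D.root else D.top x
  par_root := D.par_root
  depth_par := D.depth_par
  bag_sub s := Finset.union_subset Finset.inter_subset_right
    (Finset.inter_subset_left.trans hX)
  top_mem x hx := by
    by_cases h : x ∈ X
    · simp only [h, if_true, Finset.mem_union, Finset.mem_inter, hx, and_true, true_and, mem_below,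
        hK hx, D.anc_root]
      tauto
    · simp [h, hx, D.top_mem x (hK hx)]
  up x s hx hs := by
    by_cases h : x ∈ X
    · simp only [h, if_true] at hs
      refine ⟨hs, ?_⟩
      have hxK' := hX h
      have hxK := hK hxK'
      simp only [Finset.mem_union, Finset.mem_inter, h, hxK', and_true, true_and, mem_below,
        hxK] at hx ⊢
      have hanc : x ∈ D.bag s ∧ s ≠ D.top x ∨ D.Anc s (D.top x) := by
        by_cases hst : s = D.top x
        · exact Or.inr (hst ▸ Anc.refl D _)
        · tauto
      rcases hanc with hanc | hanc
      · exact Or.inl (D.up x s hanc.1 hanc.2).2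
      · have := (D.anc_par s).trans hanc
        tauto
    · simp only [h, if_false] at hs
      simp only [Finset.mem_union, Finset.mem_inter, h, false_and, or_false] at hx ⊢
      have := D.up x s hx.1 hs
      exact ⟨this.1, this.2, hx.2⟩
  edge x hx y hy hxy := by
    obtain ⟨s, hs⟩ := D.edge x (hK hx) y (hK hy) hxy
    exact ⟨s, by simp [hs.1, hx], by simp [hs.2, hy]⟩

theorem subset_restrict_root [DecidableEq V] (D : RootedDecomp G K ι) {K' X : Finset V}
    (hK : K' ⊆ K) (hX : X ⊆ K') :
    X ⊆ (D.restrict hK hX).bag (D.restrict hK hX).root := by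
  intro x hx
  have : x ∈ D.bag D.root ∨ x ∈ D.below D.root := by
    rw [mem_below]
    have := D.anc_root (D.top x)
    have := hK (hX hx)
    tauto
  change x ∈ (D.bag D.root ∩ K') ∪ (X ∩ D.below D.root)
  simp only [Finset.mem_union, Finset.mem_inter, hx, hX hx, true_and, and_true]
  exact this

open scoped Classical in
/-- Moving the root to one of its children. -/
noncomputable def flip (D : RootedDecomp G K ι) (c : ι) (hc : c ≠ D.root)
    (hcr : D.par c = D.root) : RootedDecomp G K ι where
  root := c
  par t := if t = c then c else if t = D.root then c else D.par t
  depth t := if D.Anc c t then D.depth t else D.depth t + D.depth c + 1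
  bag := D.bag
  top x := if x ∈ D.bag c then c else D.top x
  par_root := by simp
  depth_par t ht := by
    have hcc : D.Anc c c := Anc.refl D c
    by_cases htr : t = D.root
    · have h : ¬ D.Anc c D.root := fun h => hc (eq_root_of_anc h)
      simp only [htr, hc.symm, if_false, if_true, hcc, h]
      omega
    · have hlt := D.depth_par t htr
      by_cases hct : D.Anc c t
      · have := hct.par_of_ne (Ne.symm ht)
        simpa [ht, htr, hct, this] using hlt
      · have : ¬ D.Anc c (D.par t) := fun h => hct (h.trans (D.anc_par t))
        simpa [ht, htr, hct, this] using hlt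
  bag_sub := D.bag_sub
  top_mem x hx := by
    by_cases h : x ∈ D.bag c
    · simp [h]
    · simpa [h] using D.top_mem x hx
  up x t hx ht := by
    by_cases h : x ∈ D.bag c
    · simp only [h, if_true] at ht
      refine ⟨ht, ?_⟩
      by_cases htr : t = D.root
      · simp [htr, hc.symm, h]
      · simp only [ht, htr, if_false]
        by_cases htt : t = D.top x
        · -- `c` lies below the highest node of `x`, so this node can only be the root
          exfalso
          have h1 : D.Anc t c := htt ▸ D.top_anc h
          have h2 := h1.par_of_ne ht
          rw [hcr] at h2
          exact htr (eq_root_of_anc h2)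
        · exact (D.up x t hx htt).2
    · simp only [h, if_false] at ht
      have htc : t ≠ c := fun e => h (e ▸ hx)
      obtain ⟨h1, h2⟩ := D.up x t hx ht
      exact ⟨htc, by simpa [htc, h1] using h2⟩
  edge := D.edge

/-- Every node can be made the root without changing the bags. -/
theorem exists_reroot (D : RootedDecomp G K ι) (s : ι) :
    ∃ D' : RootedDecomp G K ι, D'.root = s ∧ D'.bag = D.bag := by
  suffices h : ∀ n : ℕ, ∀ D : RootedDecomp G K ι, D.par^[n] s = D.root →
      ∃ D' : RootedDecomp G K ι, D'.root = s ∧ D'.bag = D.bag by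
    obtain ⟨n, hn⟩ := D.anc_root s
    exact h n D hn
  clear D
  intro n
  induction n with
  | zero => exact fun D h => ⟨D, by simpa using h.symm, rfl⟩
  | succ n ih =>
    intro D hD
    by_cases hmin : ∃ i ≤ n, D.par^[i] s = D.root
    · obtain ⟨i, hi, h⟩ := hmin
      refine ih D ?_
      obtain ⟨j, rfl⟩ := Nat.exists_eq_add_of_le hi
      rw [Nat.add_comm, Function.iterate_add_apply, h, Function.iterate_fixed D.par_root]
    push Not at hmin
    have hc : D.par^[n] s ≠ D.root := hmin n le_rfl
    have hcr : D.par (D.par^[n] s) = D.root := by rwa [Function.iterate_succ_apply'] at hD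
    obtain ⟨D', h1, h2⟩ := ih (D.flip _ hc hcr) (by
      have : ∀ i ≤ n, (D.flip _ hc hcr).par^[i] s = D.par^[i] s := by
        intro i
        induction i with
        | zero => simp
        | succ i ihi =>
          intro hi
          rw [Function.iterate_succ_apply', Function.iterate_succ_apply', ihi (by omega)]
          have h1 : D.par^[i] s ≠ D.root := hmin i (by omega)
          have h2 : D.par^[i] s ≠ D.par^[n] s := fun h => by
            have h3 : D.Anc (D.par^[n] s) (D.par^[i + 1] s) := by
              obtain ⟨j, rfl⟩ := Nat.exists_eq_add_of_le hi
              exact ⟨j, by rw [← Function.iterate_add_apply, Nat.add_comm]⟩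
            have h4 := h3.depth_le
            rw [Function.iterate_succ_apply', ← h] at h4
            exact absurd (D.depth_par _ h1) (by omega)
          simp [flip, h1, h2]
      exact this n le_rfl)
    exact ⟨D', h1, h2⟩

end RootedDecomp

/-! ### Tree-decompositions with lean bags -/

/-- `(A, B)` are the two sides of a separation of `G` with separator `X`. -/
structure IsSep {V : Type*} (G : SimpleGraph V) (A B X : Finset V) : Prop where
  cover : ∀ v, v ∈ A ∨ v ∈ B ∨ v ∈ X
  disj : Disjoint A B
  disj_left : Disjoint A X
  disj_right : Disjoint B X
  not_adj : ∀ a ∈ A, ∀ b ∈ B, ¬ G.Adj a b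

theorem IsSep.symm {V : Type*} {G : SimpleGraph V} {A B X : Finset V} (h : IsSep G A B X) :
    IsSep G B A X where
  cover v := by have := h.cover v; tauto
  disj := h.disj.symm
  disj_left := h.disj_right
  disj_right := h.disj_left
  not_adj b hb a ha hab := h.not_adj a ha b hb hab.symm

theorem isSep_boundary {V : Type*} [Fintype V] [DecidableEq V] (G : SimpleGraph V)
    (C : Finset V) : IsSep G C (Finset.univ \ (C ∪ boundary G C)) (boundary G C) where
  cover v := by simp only [Finset.mem_sdiff, Finset.mem_univ, Finset.mem_union]; tauto
  disj := Finset.disjoint_left.2 fun v hv hv' => by simp [hv] at hv'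
  disj_left := Finset.disjoint_right.2 fun v hv => (mem_boundary.1 hv).1
  disj_right := Finset.disjoint_right.2 fun v hv hv' => by simp [hv] at hv'
  not_adj a ha b hb hab := by
    simp only [Finset.mem_sdiff, Finset.mem_univ, Finset.mem_union, true_and, not_or] at hb
    exact hb.2 (mem_boundary.2 ⟨hb.1, a, ha, hab⟩)

/-- A multiset obtained by splitting every entry `f s` into `a s` and `b s` is smaller in the
Dershowitz–Manna order, provided that both parts are smaller than `f s`, with the exception of
entries for which one part equals `f s` and the other part is below a fixed properly split
entry `f t`. -/
theorem isDershowitzMannaLT_of_split {ι : Type*} [Fintype ι] (f a b : ι → ℕ) (t : ι)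
    (ht : a t < f t ∧ b t < f t)
    (h : ∀ s, (a s < f s ∧ b s < f s) ∨ (a s = f s ∧ b s < f t) ∨ (b s = f s ∧ a s < f t)) :
    Multiset.IsDershowitzMannaLT (∑ s, ({a s} : Multiset ℕ) + ∑ s, ({b s} : Multiset ℕ))
      (∑ s, ({f s} : Multiset ℕ)) := by
  classical
  set P : ι → Prop := fun s => a s < f s ∧ b s < f s with hP
  refine ⟨∑ s with ¬ P s, {f s},
    ∑ s with P s, ({a s} + {b s}) + ∑ s with ¬ P s, {if a s = f s then b s else a s},
    ∑ s with P s, {f s}, ?_, ?_, ?_, ?_⟩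
  · intro h0
    have : f t ∈ ∑ s with P s, ({f s} : Multiset ℕ) :=
      Multiset.mem_sum.2 ⟨t, by simpa [hP] using ht, by simp⟩
    rw [h0] at this
    simp at this
  · rw [← Finset.sum_add_distrib,
      ← Finset.sum_filter_add_sum_filter_not Finset.univ P, add_left_comm, add_right_inj,
      ← Finset.sum_add_distrib]
    refine Finset.sum_congr rfl fun s hs => ?_
    have hs' : ¬ P s := (Finset.mem_filter.1 hs).2
    rcases h s with h | h | h
    · exact absurd h hs'
    · rw [if_pos h.1, h.1]
    · by_cases e : a s = f s
      · rw [if_pos e, e]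
      · rw [if_neg e, h.1, add_comm]
  · rw [add_comm, Finset.sum_filter_add_sum_filter_not]
  · intro y hy
    rcases Multiset.mem_add.1 hy with hy | hy
    · obtain ⟨s, hs, hy⟩ := Multiset.mem_sum.1 hy
      have hs' : P s := (Finset.mem_filter.1 hs).2
      refine ⟨f s, Multiset.mem_sum.2 ⟨s, hs, by simp⟩, ?_⟩
      rcases Multiset.mem_add.1 hy with hy | hy
      · rw [Multiset.mem_singleton.1 hy]; exact hs'.1
      · rw [Multiset.mem_singleton.1 hy]; exact hs'.2
    · obtain ⟨s, hs, hy⟩ := Multiset.mem_sum.1 hy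
      have hs' : ¬ P s := (Finset.mem_filter.1 hs).2
      refine ⟨f t, Multiset.mem_sum.2 ⟨t, by simpa [hP] using ht, by simp⟩, ?_⟩
      rw [Multiset.mem_singleton.1 hy]
      rcases h s with h | h | h
      · exact absurd h hs'
      · rw [if_pos h.1]; exact h.2
      · split_ifs with e
        · rw [h.1, ← e]; exact h.2
        · exact h.2

namespace RootedDecomp

variable {V : Type*} {G : SimpleGraph V}

/-- The multiset of bag sizes. -/
def sizes {K : Finset V} {ι : Type} [Fintype ι] (D : RootedDecomp G K ι) : Multiset ℕ :=
  ∑ s, {(D.bag s).card}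

/-- If the vertices of the separator below a node `s` are at least as many as the vertices of the
side `B` in the bag of `s`, then the former can be exchanged for the latter, which are closer to
the root. -/
theorem exists_isSep_closer [Fintype V] [DecidableEq V] {ι : Type}
    (D : RootedDecomp G Finset.univ ι) {A B X : Finset V} (h : IsSep G A B X) (s : ι)
    (hne : (X ∩ D.below s).Nonempty) (hle : (D.bag s ∩ B).card ≤ (X ∩ D.below s).card) :
    ∃ A' B' X', IsSep G A' B' X' ∧ X'.card ≤ X.card ∧
      ∑ x ∈ X', D.depth (D.top x) < ∑ x ∈ X, D.depth (D.top x) ∧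
      D.bag D.root ∩ (A ∪ X) ⊆ D.bag D.root ∩ (A' ∪ X') ∧
      D.bag D.root ∩ (B ∪ X) ⊆ D.bag D.root ∩ (B' ∪ X') := by
  have hXcard : (X \ D.below s).card + (X ∩ D.below s).card = X.card :=
    Finset.card_sdiff_add_card_inter _ _
  refine ⟨A ∪ D.below s, B \ (D.below s ∪ D.bag s), (X \ D.below s) ∪ (D.bag s ∩ B),
    ⟨?_, ?_, ?_, ?_, ?_⟩, ?_, ?_, ?_, ?_⟩
  · intro v
    have := h.cover v
    simp only [Finset.mem_union, Finset.mem_sdiff, Finset.mem_inter]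
    tauto
  · refine Finset.disjoint_left.2 fun v hv hv' => ?_
    have := fun hA : v ∈ A => Finset.disjoint_left.1 h.disj hA
    simp only [Finset.mem_union, Finset.mem_sdiff] at hv hv'
    tauto
  · refine Finset.disjoint_left.2 fun v hv hv' => ?_
    have h1 := fun hA : v ∈ A => Finset.disjoint_left.1 h.disj hA
    have h2 := fun hA : v ∈ A => Finset.disjoint_left.1 h.disj_left hA
    have h3 : v ∈ D.below s → v ∉ D.bag s := fun h => (mem_below.1 h).2.1
    simp only [Finset.mem_union, Finset.mem_sdiff, Finset.mem_inter] at hv hv'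
    tauto
  · refine Finset.disjoint_left.2 fun v hv hv' => ?_
    have h2 := fun hB : v ∈ B => Finset.disjoint_left.1 h.disj_right hB
    simp only [Finset.mem_union, Finset.mem_sdiff, Finset.mem_inter] at hv hv'
    tauto
  · intro a ha b hb hab
    simp only [Finset.mem_union, Finset.mem_sdiff, not_or] at ha hb
    rcases ha with ha | ha
    · exact h.not_adj a ha b hb.1 hab
    · exact hb.2.2 (D.mem_bag_of_adj_below ha (Finset.mem_univ b) hab hb.2.1)
  · exact (Finset.card_union_le _ _).trans (by omega)
  · have h1 : ∑ x ∈ D.bag s ∩ B, D.depth (D.top x) ≤ (D.bag s ∩ B).card * D.depth s := by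
      rw [← smul_eq_mul]
      exact Finset.sum_le_card_nsmul _ _ _ fun x hx =>
        (D.top_anc (Finset.mem_inter.1 hx).1).depth_le
    have h2 : (X ∩ D.below s).card * D.depth s < ∑ x ∈ X ∩ D.below s, D.depth (D.top x) := by
      rw [← smul_eq_mul, ← Finset.sum_const]
      exact Finset.sum_lt_sum_of_nonempty hne fun x hx =>
        D.depth_lt_of_mem_below (Finset.mem_inter.1 hx).2
    have h3 := Nat.mul_le_mul_right (D.depth s) hle
    have h4 : ∑ x ∈ X \ D.below s, D.depth (D.top x) + ∑ x ∈ X ∩ D.below s, D.depth (D.top x) =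
        ∑ x ∈ X, D.depth (D.top x) := by
      rw [add_comm, Finset.sum_inter_add_sum_sdiff]
    have h5 : ∑ x ∈ (X \ D.below s) ∪ (D.bag s ∩ B), D.depth (D.top x) ≤
        ∑ x ∈ X \ D.below s, D.depth (D.top x) + ∑ x ∈ D.bag s ∩ B, D.depth (D.top x) := by
      rw [← Finset.sum_union_inter]; exact Nat.le_add_right _ _
    omega
  · intro v hv
    have := fun hv => D.notMem_below_of_mem_root (s := s) (x := v) hv
    simp only [Finset.mem_inter, Finset.mem_union, Finset.mem_sdiff] at hv ⊢
    tauto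
  · intro v hv
    have := fun hv => D.notMem_below_of_mem_root (s := s) (x := v) hv
    simp only [Finset.mem_inter, Finset.mem_union, Finset.mem_sdiff] at hv ⊢
    tauto

/-- Splitting a decomposition along a separation `(A, B)` with separator `X`: the two restrictions
to `A ∪ X` and `B ∪ X` are glued along root bags containing `X`. -/
theorem exists_split [Fintype V] [DecidableEq V] {ι : Type} [Fintype ι]
    (D : RootedDecomp G Finset.univ ι) {A B X : Finset V} (h : IsSep G A B X) :
    ∃ D' : RootedDecomp G Finset.univ (ι ⊕ ι), D'.sizes =
      ∑ s, {((D.bag s ∩ (A ∪ X)) ∪ (X ∩ D.below s)).card} +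
      ∑ s, {((D.bag s ∩ (B ∪ X)) ∪ (X ∩ D.below s)).card} := by
  have hinter : (A ∪ X) ∩ (B ∪ X) ⊆ X := by
    intro v hv
    have := fun hA : v ∈ A => Finset.disjoint_left.1 h.disj hA
    simp only [Finset.mem_inter, Finset.mem_union] at hv
    tauto
  have key : ∀ K : Finset V, K = Finset.univ → ∀ D₀ : RootedDecomp G K (ι ⊕ ι),
      ∃ D' : RootedDecomp G Finset.univ (ι ⊕ ι), D'.sizes = D₀.sizes := by
    rintro _ rfl D₀; exact ⟨D₀, rfl⟩
  obtain ⟨D', hD'⟩ := key ((A ∪ X) ∪ (B ∪ X)) (by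
      ext v
      have := h.cover v
      simp only [Finset.mem_union, Finset.mem_univ, iff_true]
      tauto)
    (glue (D.restrict (Finset.subset_univ (A ∪ X)) Finset.subset_union_right)
      (D.restrict (Finset.subset_univ (B ∪ X)) Finset.subset_union_right)
      (hinter.trans (D.subset_restrict_root _ _)) (hinter.trans (D.subset_restrict_root _ _)) (by
        intro x hx y hy hxy
        simp only [Finset.mem_union] at hx hy ⊢
        by_contra hcon
        push Not at hcon
        exact h.not_adj x (by tauto) y (by tauto) hxy))
  refine ⟨D', hD'.trans ?_⟩
  rw [sizes, Fintype.sum_sum_type]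
  rfl

/-- Every finite graph has a tree-decomposition in which no two sets of the same bag are separated
by fewer vertices than each of them has. Such a decomposition is found by minimising the
multiset of bag sizes: a separation violating the claim at the bag of `t`, with separator as close
to `t` as possible, could be used to split the decomposition into one with smaller bags. -/
theorem exists_lean [Fintype V] [DecidableEq V] (G : SimpleGraph V) :
    ∃ (ι : Type) (_ : Fintype ι) (D : RootedDecomp G Finset.univ ι), ∀ t, ∀ A B X : Finset V,
      IsSep G A B X →
      (D.bag t ∩ (A ∪ X)).card ≤ X.card ∨ (D.bag t ∩ (B ∪ X)).card ≤ X.card := by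
  obtain ⟨M, ⟨ι, hι, D, rfl⟩, hmin⟩ := Multiset.wellFounded_isDershowitzMannaLT.has_min
    {M : Multiset ℕ | ∃ (ι : Type) (_ : Fintype ι) (D : RootedDecomp G Finset.univ ι), D.sizes = M}
    ⟨_, Unit, inferInstance, single G Finset.univ, rfl⟩
  refine ⟨ι, hι, D, fun t A₀ B₀ X₀ hsep₀ => ?_⟩
  by_contra hbad₀
  push Not at hbad₀
  obtain ⟨D', hroot, hbag⟩ := D.exists_reroot t
  have hsizes : D'.sizes = D.sizes := by simp only [sizes, hbag]
  rw [← hsizes] at hmin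
  rw [← hbag, ← hroot] at hbad₀
  clear hsizes hbag D
  -- choose a bad separation whose separator is closest to the root
  have hclosest : ∃ A B X, IsSep G A B X ∧ X.card ≤ X₀.card ∧
      X₀.card < (D'.bag D'.root ∩ (A ∪ X)).card ∧ X₀.card < (D'.bag D'.root ∩ (B ∪ X)).card ∧
      ∀ A' B' X', IsSep G A' B' X' → X'.card ≤ X₀.card →
        X₀.card < (D'.bag D'.root ∩ (A' ∪ X')).card →
        X₀.card < (D'.bag D'.root ∩ (B' ∪ X')).card →
        ∑ x ∈ X, D'.depth (D'.top x) ≤ ∑ x ∈ X', D'.depth (D'.top x) := by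
    classical
    obtain ⟨⟨A, B, X⟩, hABX, hm⟩ := Finset.exists_min_image
      ((Finset.univ : Finset (Finset V × Finset V × Finset V)).filter fun p =>
        IsSep G p.1 p.2.1 p.2.2 ∧ p.2.2.card ≤ X₀.card ∧
        X₀.card < (D'.bag D'.root ∩ (p.1 ∪ p.2.2)).card ∧
        X₀.card < (D'.bag D'.root ∩ (p.2.1 ∪ p.2.2)).card)
      (fun p => ∑ x ∈ p.2.2, D'.depth (D'.top x))
      ⟨(A₀, B₀, X₀), by simpa using ⟨hsep₀, hbad₀⟩⟩
    simp only [Finset.mem_filter, Finset.mem_univ, true_and] at hABX hm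
    exact ⟨A, B, X, hABX.1, hABX.2.1, hABX.2.2.1, hABX.2.2.2, fun A' B' X' h1 h2 h3 h4 =>
      hm (A', B', X') ⟨h1, h2, h3, h4⟩⟩
  obtain ⟨A, B, X, hsep, hX, hA, hB, hclose⟩ := hclosest
  have hBs : ∀ s, X ∩ D'.below s = ∅ ∨ (X ∩ D'.below s).card < (D'.bag s ∩ B).card := by
    intro s
    by_contra hcon
    push Not at hcon
    obtain ⟨A', B', X', h1, h2, h3, h4, h5⟩ := D'.exists_isSep_closer hsep s hcon.1 hcon.2
    exact absurd (hclose A' B' X' h1 (h2.trans hX) (hA.trans_le (Finset.card_le_card h4))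
      (hB.trans_le (Finset.card_le_card h5))) (not_le.2 h3)
  have hAs : ∀ s, X ∩ D'.below s = ∅ ∨ (X ∩ D'.below s).card < (D'.bag s ∩ A).card := by
    intro s
    by_contra hcon
    push Not at hcon
    obtain ⟨B', A', X', h1, h2, h3, h4, h5⟩ := D'.exists_isSep_closer hsep.symm s hcon.1 hcon.2
    exact absurd (hclose A' B' X' h1.symm (h2.trans hX) (hA.trans_le (Finset.card_le_card h5))
      (hB.trans_le (Finset.card_le_card h4))) (not_le.2 h3)
  -- sizes of the bags in terms of the parts of a bag
  have hAX : ∀ s, (D'.bag s ∩ (A ∪ X)).card = (D'.bag s ∩ A).card + (D'.bag s ∩ X).card := by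
    intro s
    rw [Finset.inter_union_distrib_left, Finset.card_union_of_disjoint]
    exact hsep.disj_left.mono Finset.inter_subset_right Finset.inter_subset_right
  have hBX : ∀ s, (D'.bag s ∩ (B ∪ X)).card = (D'.bag s ∩ B).card + (D'.bag s ∩ X).card := by
    intro s
    rw [Finset.inter_union_distrib_left, Finset.card_union_of_disjoint]
    exact hsep.disj_right.mono Finset.inter_subset_right Finset.inter_subset_right
  have hbagcard : ∀ s, (D'.bag s).card =
      (D'.bag s ∩ A).card + (D'.bag s ∩ B).card + (D'.bag s ∩ X).card := by
    intro s
    rw [add_assoc, ← hBX, ← Finset.card_union_of_disjoint]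
    · congr 1
      ext v
      have := hsep.cover v
      simp only [Finset.mem_union, Finset.mem_inter]
      tauto
    · exact (Finset.disjoint_union_right.2 ⟨hsep.disj, hsep.disj_left⟩).mono
        Finset.inter_subset_right Finset.inter_subset_right
  have hdisj : ∀ s (Y : Finset V), Disjoint (D'.bag s ∩ Y) (X ∩ D'.below s) := fun s Y =>
    Finset.disjoint_left.2 fun v hv hv' =>
      (mem_below.1 (Finset.mem_inter.1 hv').2).2.1 (Finset.mem_inter.1 hv).1
  have hroot_below : (D'.bag D'.root ∩ X).card + (X ∩ D'.below D'.root).card ≤ X.card := by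
    rw [← Finset.card_union_of_disjoint (hdisj _ _)]
    exact Finset.card_le_card (Finset.union_subset Finset.inter_subset_right
      Finset.inter_subset_left)
  have hXs : ∀ s, (D'.bag s ∩ X).card ≤ X.card := fun s =>
    Finset.card_le_card Finset.inter_subset_right
  obtain ⟨D₂, hD₂⟩ := D'.exists_split hsep
  refine hmin D₂.sizes ⟨_, inferInstance, D₂, rfl⟩ ?_
  rw [hD₂]
  refine isDershowitzMannaLT_of_split (fun s => (D'.bag s).card) _ _ D'.root ?_ ?_
  · rw [Finset.card_union_of_disjoint (hdisj _ _), Finset.card_union_of_disjoint (hdisj _ _),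
      hAX, hBX, hbagcard]
    rw [hAX] at hA
    rw [hBX] at hB
    omega
  · intro s
    rw [Finset.card_union_of_disjoint (hdisj _ _), Finset.card_union_of_disjoint (hdisj _ _),
      hAX, hBX, hbagcard s, hbagcard D'.root]
    rw [hAX] at hA
    rw [hBX] at hB
    have h1 := hBs s
    have h2 := hAs s
    rw [← Finset.card_eq_zero] at h1 h2
    have h3 := hXs s
    omega

end RootedDecomp

/-- Every non-empty finite graph has a vertex `v` such that no two subsets of its closed
neighbourhood are separated by fewer vertices than each of them has: a vertex in an outermost
part of a lean tree-decomposition. -/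
theorem exists_lean_closed_nbhd {V : Type*} [Fintype V] [DecidableEq V] [Nonempty V]
    (G : SimpleGraph V) : ∃ v : V, ∀ A B X : Finset V, IsSep G A B X →
      (insert v (boundary G {v}) ∩ (A ∪ X)).card ≤ X.card ∨
      (insert v (boundary G {v}) ∩ (B ∪ X)).card ≤ X.card := by
  obtain ⟨ι, _, D, hD⟩ := RootedDecomp.exists_lean G
  obtain ⟨v, -, hv⟩ := Finset.exists_max_image (Finset.univ : Finset V)
    (fun v => D.depth (D.top v)) Finset.univ_nonempty
  have hsub : insert v (boundary G {v}) ⊆ D.bag (D.top v) := by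
    refine Finset.insert_subset (D.top_mem v (Finset.mem_univ v)) fun w hw => ?_
    obtain ⟨-, u, hu, huw⟩ := mem_boundary.1 hw
    rw [Finset.mem_singleton] at hu
    subst hu
    obtain ⟨r, hur, hwr⟩ := D.edge u (Finset.mem_univ u) w (Finset.mem_univ w) huw
    rcases D.anc_top_or_mem hwr (D.top_anc hur) with h | h
    · by_contra hwt
      exact absurd (hv w (Finset.mem_univ w)) (not_le.2 (D.depth_lt_of_mem_below
        (RootedDecomp.mem_below.2 ⟨Finset.mem_univ w, hwt, h⟩)))
    · exact h
  refine ⟨v, fun A B X h => ?_⟩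
  rcases hD (D.top v) A B X h with h | h
  · exact Or.inl ((Finset.card_le_card (Finset.inter_subset_inter_right hsub)).trans h)
  · exact Or.inr ((Finset.card_le_card (Finset.inter_subset_inter_right hsub)).trans h)

/-! ### Edge contraction and the density bound -/

theorem isConn_of_induce_connected {V : Type*} {G : SimpleGraph V} {A : Finset V}
    (h : (G.induce (A : Set V)).Connected) : IsConn G A := by
  obtain ⟨⟨a, ha⟩⟩ := h.nonempty
  refine ⟨⟨a, ha⟩, ?_⟩
  rintro Z ⟨x, hx, hxZ⟩ hZ y hy
  obtain ⟨p⟩ := h.preconnected ⟨x, hx⟩ ⟨y, hy⟩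
  have : ∀ (u w : (A : Set V)), (G.induce (A : Set V)).Walk u w → u.1 ∈ Z → w.1 ∈ Z := by
    intro u w p
    induction p with
    | nil => exact id
    | cons hadj _ ih => exact fun hu => ih (hZ _ (Subtype.prop _) hu _ (Subtype.prop _) hadj)
  exact this _ _ p hxZ

/-- The graph obtained from `G` by identifying `y` with `x`. -/
def contract {V : Type*} (G : SimpleGraph V) (x y : V) : SimpleGraph {v : V // v ≠ y} where
  Adj a b := a ≠ b ∧ (G.Adj a b ∨ (a.1 = x ∧ G.Adj y b) ∨ (b.1 = x ∧ G.Adj y a))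
  symm := ⟨fun a b h => ⟨h.1.symm, by
    rcases h.2 with h | h | h
    · exact Or.inl h.symm
    · exact Or.inr (Or.inr h)
    · exact Or.inr (Or.inl h)⟩⟩
  loopless := ⟨fun a h => h.1 rfl⟩

section Contract

variable {V : Type*} {G : SimpleGraph V} {𝒢 : Type*} [AddCommGroup 𝒢] {ℓ : V → 𝒢} {x y : V}

/-- Contracting an edge and adding the labels of its ends keeps a labelling zero-avoiding. -/
theorem IsZeroAvoiding.contract [DecidableEq V] (hℓ : IsZeroAvoiding G ℓ) (hxy : G.Adj x y) :
    IsZeroAvoiding (contract G x y) fun a => if a.1 = x then ℓ x + ℓ y else ℓ a := by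
  intro A hA hconn hsum
  have hA' := isConn_of_induce_connected hconn
  set B : Finset V := A.map (Function.Embedding.subtype _) with hB
  have hyB : y ∉ B := by
    intro h
    obtain ⟨a, -, ha⟩ := Finset.mem_map.1 h
    exact a.2 ha
  have hmem : ∀ v, v ∈ B ↔ ∃ h : v ≠ y, (⟨v, h⟩ : {v : V // v ≠ y}) ∈ A := by
    intro v
    rw [hB, Finset.mem_map]
    constructor
    · rintro ⟨a, ha, rfl⟩; exact ⟨a.2, ha⟩
    · rintro ⟨h, ha⟩; exact ⟨_, ha, rfl⟩
  have hsumB : ∑ v ∈ B, (if v = x then ℓ x + ℓ y else ℓ v) = 0 := by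
    rw [hB, Finset.sum_map]; exact hsum
  by_cases hxB : x ∈ B
  · have hconnB : IsConn G (insert y B) := by
      refine ⟨⟨y, by simp⟩, fun Z hZ hcl => ?_⟩
      have hxyZ : x ∈ Z ↔ y ∈ Z :=
        ⟨fun h => hcl x (by simp [hxB]) h y (by simp) hxy,
          fun h => hcl y (by simp) h x (by simp [hxB]) hxy.symm⟩
      have h1 : ∀ a ∈ A, a ∈ {a : {v : V // v ≠ y} | a.1 ∈ Z} := by
        refine hA'.2 _ ?_ ?_
        · obtain ⟨z, hz, hzZ⟩ := hZ
          rcases Finset.mem_insert.1 hz with rfl | hz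
          · obtain ⟨h, ha⟩ := (hmem x).1 hxB
            exact ⟨_, ha, hxyZ.2 hzZ⟩
          · obtain ⟨h, ha⟩ := (hmem z).1 hz
            exact ⟨_, ha, hzZ⟩
        · rintro a ha haZ b hb ⟨-, hab⟩
          have haB : a.1 ∈ insert y B := Finset.mem_insert_of_mem ((hmem _).2 ⟨a.2, ha⟩)
          have hbB : b.1 ∈ insert y B := Finset.mem_insert_of_mem ((hmem _).2 ⟨b.2, hb⟩)
          rcases hab with hab | ⟨hax, hab⟩ | ⟨hbx, hab⟩
          · exact hcl _ haB haZ _ hbB hab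
          · exact hcl y (by simp) (hxyZ.1 (hax ▸ haZ)) _ hbB hab
          · rw [Set.mem_ofPred_eq, hbx]
            exact hxyZ.2 (hcl _ haB haZ y (by simp) hab.symm)
      intro v hv
      rcases Finset.mem_insert.1 hv with rfl | hv
      · obtain ⟨h, ha⟩ := (hmem x).1 hxB
        exact hxyZ.1 (h1 _ ha)
      · obtain ⟨h, ha⟩ := (hmem v).1 hv
        exact h1 _ ha
    refine hℓ _ hconnB.1 hconnB.induce_connected ?_
    rw [Finset.sum_insert hyB, ← hsumB, ← Finset.add_sum_erase _ _ hxB,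
      ← Finset.add_sum_erase _ _ hxB, if_pos rfl]
    have : ∑ v ∈ B.erase x, (if v = x then ℓ x + ℓ y else ℓ v) = ∑ v ∈ B.erase x, ℓ v :=
      Finset.sum_congr rfl fun v hv => if_neg (Finset.ne_of_mem_erase hv)
    rw [this]; abel
  · have hconnB : IsConn G B := by
      refine ⟨hA.map, fun Z hZ hcl => ?_⟩
      have h1 : ∀ a ∈ A, a ∈ {a : {v : V // v ≠ y} | a.1 ∈ Z} := by
        refine hA'.2 _ ?_ ?_
        · obtain ⟨z, hz, hzZ⟩ := hZ
          obtain ⟨h, ha⟩ := (hmem z).1 hz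
          exact ⟨_, ha, hzZ⟩
        · rintro a ha haZ b hb ⟨-, hab⟩
          have haB : a.1 ∈ B := (hmem _).2 ⟨a.2, ha⟩
          have hbB : b.1 ∈ B := (hmem _).2 ⟨b.2, hb⟩
          rcases hab with hab | ⟨hax, -⟩ | ⟨hbx, -⟩
          · exact hcl _ haB haZ _ hbB hab
          · exact absurd (hax ▸ haB) hxB
          · exact absurd (hbx ▸ hbB) hxB
      intro v hv
      obtain ⟨h, ha⟩ := (hmem v).1 hv
      exact h1 _ ha
    refine hℓ _ hconnB.1 hconnB.induce_connected ?_
    rw [← hsumB]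
    refine Finset.sum_congr rfl fun v hv => (if_neg ?_).symm
    rintro rfl
    exact hxB hv

/-- Deleting an isolated vertex keeps a labelling zero-avoiding. -/
theorem IsZeroAvoiding.contract_isolated (hℓ : IsZeroAvoiding G ℓ) (hy : ∀ v, ¬ G.Adj y v) :
    IsZeroAvoiding (ZeroForcing.contract G x y) fun a => ℓ a := by
  intro A hA hconn hsum
  have hA' := isConn_of_induce_connected hconn
  have hconnB : IsConn G (A.map (Function.Embedding.subtype _)) := by
    refine ⟨hA.map, fun Z hZ hcl => ?_⟩
    have h1 : ∀ a ∈ A, a ∈ {a : {v : V // v ≠ y} | a.1 ∈ Z} := by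
      refine hA'.2 _ ?_ ?_
      · obtain ⟨z, hz, hzZ⟩ := hZ
        obtain ⟨a, ha, rfl⟩ := Finset.mem_map.1 hz
        exact ⟨a, ha, hzZ⟩
      · rintro a ha haZ b hb ⟨-, hab⟩
        rcases hab with hab | ⟨-, hab⟩ | ⟨-, hab⟩
        · exact hcl _ (Finset.mem_map_of_mem _ ha) haZ _ (Finset.mem_map_of_mem _ hb) hab
        · exact absurd hab (hy _)
        · exact absurd hab (hy _)
    intro v hv
    obtain ⟨a, ha, rfl⟩ := Finset.mem_map.1 hv
    exact h1 _ ha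
  refine hℓ _ hconnB.1 hconnB.induce_connected ?_
  rw [Finset.sum_map]
  exact hsum

open scoped Classical in
/-- The number of ordered pairs of adjacent vertices, that is, twice the number of edges. -/
noncomputable def adjPairs {V : Type*} [Fintype V] (G : SimpleGraph V) : ℕ :=
  (Finset.univ.filter fun p : V × V => G.Adj p.1 p.2).card

theorem sum_degree_eq_adjPairs [Fintype V] [DecidableRel G.Adj] :
    ∑ v, G.degree v = adjPairs G := by
  classical
  rw [adjPairs, Finset.card_filter, Fintype.sum_prod_type]
  refine Finset.sum_congr rfl fun v _ => ?_
  rw [← SimpleGraph.card_neighborFinset_eq_degree, SimpleGraph.neighborFinset_eq_filter,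
    Finset.card_filter]
  refine Finset.sum_congr rfl fun w _ => ?_
  congr

open scoped Classical in
/-- The neighbours of `y` that are equal or adjacent to `x`. -/
noncomputable def closedCommonNbrs {V : Type*} [Fintype V] (G : SimpleGraph V) (x y : V) :
    Finset V :=
  Finset.univ.filter fun v => G.Adj y v ∧ (v = x ∨ G.Adj x v)

theorem mem_closedCommonNbrs [Fintype V] {v : V} :
    v ∈ closedCommonNbrs G x y ↔ G.Adj y v ∧ (v = x ∨ G.Adj x v) := by
  simp [closedCommonNbrs]

/-- Identifying `y` with `x` destroys only the edges from `y` to `x` and to common neighbours. -/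
theorem adjPairs_le_contract [Fintype V] [DecidableEq V] (hxy : x ≠ y) :
    adjPairs G ≤ adjPairs (ZeroForcing.contract G x y) + 2 * (closedCommonNbrs G x y).card := by
  classical
  set T := closedCommonNbrs G x y with hT
  set bad : Finset (V × V) := {y} ×ˢ T ∪ T ×ˢ {y} with hbad
  have hbadcard : bad.card ≤ 2 * T.card := by
    refine (Finset.card_union_le _ _).trans ?_
    simp [two_mul]
  set P : Finset (V × V) := Finset.univ.filter fun p : V × V => G.Adj p.1 p.2 with hP
  have hle : (P \ bad).card ≤ adjPairs (ZeroForcing.contract G x y) := by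
    set π : V → {v : V // v ≠ y} := fun v => if h : v = y then ⟨x, hxy⟩ else ⟨v, h⟩ with hπ
    have hπy : (π y).1 = x := by simp [hπ]
    have hπne : ∀ v, v ≠ y → (π v).1 = v := fun v hv => by simp [hπ, hv]
    have hgood : ∀ a b, (a, b) ∈ P \ bad ↔
        G.Adj a b ∧ ¬ (a = y ∧ b ∈ T) ∧ ¬ (a ∈ T ∧ b = y) := by
      intro a b
      simp only [hP, hbad, Finset.mem_sdiff, Finset.mem_filter, Finset.mem_univ, true_and,
        Finset.mem_union, Finset.mem_product, Finset.mem_singleton, not_or]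
    refine Finset.card_le_card_of_injOn (fun p => (π p.1, π p.2)) ?_ ?_
    · rintro ⟨a, b⟩ hab
      obtain ⟨h1, h2, h3⟩ := (hgood a b).1 hab
      simp only [Finset.coe_filter, Finset.mem_univ, true_and, Set.mem_ofPred_eq]
      simp only [hT, mem_closedCommonNbrs] at h2 h3
      by_cases ha : a = y
      · subst ha
        have hb : b ≠ a := h1.ne'
        refine ⟨fun h => ?_, Or.inr (Or.inl ⟨hπy, by rwa [hπne b hb]⟩)⟩
        have := congrArg Subtype.val h
        rw [hπy, hπne b hb] at this
        exact h2 ⟨rfl, h1, Or.inl this.symm⟩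
      · by_cases hb : b = y
        · subst hb
          refine ⟨fun h => ?_, Or.inr (Or.inr ⟨hπy, by rw [hπne a ha]; exact h1.symm⟩)⟩
          have := congrArg Subtype.val h
          rw [hπy, hπne a ha] at this
          exact h3 ⟨⟨h1.symm, Or.inl this⟩, rfl⟩
        · refine ⟨fun h => ?_, Or.inl (by rwa [hπne a ha, hπne b hb])⟩
          have := congrArg Subtype.val h
          rw [hπne a ha, hπne b hb] at this
          exact h1.ne this
    · rintro ⟨a, b⟩ hab ⟨a', b'⟩ hab' h
      obtain ⟨h1, h2, h3⟩ := (hgood a b).1 hab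
      obtain ⟨h1', h2', h3'⟩ := (hgood a' b').1 hab'
      simp only [hT, mem_closedCommonNbrs] at h2 h3 h2' h3'
      have e1 : (π a).1 = (π a').1 := congrArg (fun p => p.1.1) h
      have e2 : (π b).1 = (π b').1 := congrArg (fun p => p.2.1) h
      have hval : ∀ v, (π v).1 = if v = y then x else v := by
        intro v
        by_cases hv : v = y
        · rw [if_pos hv, hv, hπy]
        · rw [if_neg hv, hπne v hv]
      rw [hval, hval] at e1 e2
      have n1 := h1.ne
      have n1' := h1'.ne
      by_cases ha : a = y <;> by_cases ha' : a' = y <;> by_cases hb : b = y <;>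
        by_cases hb' : b' = y <;> simp only [ha, ha', hb, hb', if_true, if_false] at * <;>
        first
        | rfl
        | (subst_vars; exact absurd rfl ‹_›)
        | (subst_vars; simp_all [SimpleGraph.adj_comm])
  have h1 : P.card ≤ (P \ bad).card + bad.card := by
    have := Finset.card_le_card_sdiff_add_card (s := P) (t := bad)
    omega
  have h2 : adjPairs G = P.card := rfl
  omega

end Contract

/-- A zero-avoiding graph has fewer than `(davenport 𝒢 - 2) * n` edges. In a minimal
counterexample every edge has at least `davenport 𝒢 - 2` common neighbours of its ends, which makes
the closed neighbourhood of a vertex in an outermost part of a lean tree-decomposition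
inseparable. -/
theorem adjPairs_lt_of_isZeroAvoiding {𝒢 : Type*} [AddCommGroup 𝒢] (hD : 2 < davenport 𝒢)
    (n : ℕ) : ∀ (V : Type*) [Fintype V] [DecidableEq V] (G : SimpleGraph V) (ℓ : V → 𝒢),
      Fintype.card V = n + 1 → IsZeroAvoiding G ℓ →
      adjPairs G < 2 * (davenport 𝒢 - 2) * (n + 1) := by
  induction n with
  | zero =>
    intro V _ _ G ℓ hV _
    have h0 : adjPairs G = 0 := by
      classical
      rw [adjPairs, Finset.card_eq_zero, Finset.filter_eq_empty_iff]
      rintro ⟨a, b⟩ - hab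
      have := Fintype.card_le_one_iff.1 hV.le a b
      exact hab.ne this
    omega
  | succ n ih =>
    intro V _ _ G ℓ hV hℓ
    by_contra hcon
    push Not at hcon
    have hcardW : ∀ y : V, Fintype.card {v : V // v ≠ y} = n + 1 := by
      intro y
      rw [Fintype.card_subtype_compl, hV]
      simp
    have hmul : 2 * (davenport 𝒢 - 2) * (n + 1 + 1) =
        2 * (davenport 𝒢 - 2) * (n + 1) + 2 * (davenport 𝒢 - 2) := by ring
    have hedge : ∀ x y, G.Adj x y → davenport 𝒢 - 1 ≤ (closedCommonNbrs G x y).card := by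
      intro x y hxy
      have h1 := ih _ (contract G x y) _ (hcardW y) (hℓ.contract hxy)
      have h2 := adjPairs_le_contract (G := G) hxy.ne
      omega
    have hnotiso : ∀ y, ∃ x, G.Adj x y := by
      intro y
      by_contra hy
      push Not at hy
      have hne : ∃ x, x ≠ y := by
        obtain ⟨x⟩ : Nonempty {v : V // v ≠ y} := by
          rw [← Fintype.card_pos_iff, hcardW]; omega
        exact ⟨x.1, x.2⟩
      obtain ⟨x, hx⟩ := hne
      have h1 := ih _ (contract G x y) _ (hcardW y)
        (hℓ.contract_isolated fun v hv => hy v hv.symm)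
      have h2 := adjPairs_le_contract (G := G) hx
      have h3 : (closedCommonNbrs G x y).card = 0 := by
        rw [Finset.card_eq_zero, Finset.eq_empty_iff_forall_notMem]
        intro v hv
        exact hy v (mem_closedCommonNbrs.1 hv).1.symm
      omega
    have : Nonempty V := Fintype.card_pos_iff.1 (by omega)
    obtain ⟨v, hv⟩ := exists_lean_closed_nbhd G
    set Q : Finset V := insert v (boundary G {v}) with hQ
    have hQmem : ∀ w, w ∈ Q ↔ w = v ∨ G.Adj v w := by
      intro w
      rw [hQ, Finset.mem_insert, mem_boundary]
      constructor
      · rintro (h | ⟨-, u, hu, h⟩)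
        · exact Or.inl h
        · rw [Finset.mem_singleton] at hu
          exact Or.inr (hu ▸ h)
      · rintro (h | h)
        · exact Or.inl h
        · exact Or.inr ⟨by simpa using h.ne', v, by simp, h⟩
    have hQcard : davenport 𝒢 ≤ Q.card := by
      obtain ⟨x, hx⟩ := hnotiso v
      have h1 := hedge x v hx
      have h2 : insert v (closedCommonNbrs G x v) ⊆ Q := by
        intro w hw
        rw [hQmem]
        rcases Finset.mem_insert.1 hw with h | h
        · exact Or.inl h
        · exact Or.inr (mem_closedCommonNbrs.1 h).1
      have h3 := Finset.card_le_card h2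
      rw [Finset.card_insert_of_notMem (fun h => (mem_closedCommonNbrs.1 h).1.ne rfl)] at h3
      omega
    -- closed neighbourhoods inside `Q` have at least `davenport 𝒢 - 1` elements
    have hlocal : ∀ w ∈ Q, ∀ S : Finset V, w ∈ S → (∀ u, G.Adj w u → u ∈ S) →
        davenport 𝒢 - 1 ≤ (Q ∩ S).card := by
      intro w hw S hwS hS
      rcases (hQmem w).1 hw with rfl | hvw
      · have : Q ∩ S = Q := by
          refine Finset.inter_eq_left.2 fun u hu => ?_
          rcases (hQmem u).1 hu with rfl | h
          · exact hwS
          · exact hS u h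
        rw [this]; omega
      · refine (hedge w v hvw.symm).trans (Finset.card_le_card fun u hu => ?_)
        obtain ⟨h1, h2⟩ := mem_closedCommonNbrs.1 hu
        refine Finset.mem_inter.2 ⟨(hQmem u).2 (Or.inr h1), ?_⟩
        rcases h2 with rfl | h2
        · exact hwS
        · exact hS u h2
    obtain ⟨Q', hQ', hQ'card⟩ := Finset.exists_subset_card_eq hQcard
    let e : Fin (davenport 𝒢) ≃ Q' := (Finset.equivFinOfCardEq hQ'card).symm
    refine not_isZeroAvoiding_of_inseparable (by omega) (fun i => {(e i).1})
      (fun i => isConn_singleton _) (fun i j hij => ?_) (fun i j _ C hi hj => ?_) hℓ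
    · rw [Finset.disjoint_singleton]
      exact fun h => hij (e.injective (Subtype.ext h))
    · rw [Finset.singleton_subset_iff] at hi
      rw [Finset.disjoint_singleton_left, Finset.mem_union, not_or] at hj
      by_contra hlt
      have h1 := hlocal _ (hQ' (e i).2) (C ∪ boundary G C) (by simp [hi]) fun u hu => by
        by_cases huC : u ∈ C
        · simp [huC]
        · exact Finset.mem_union_right _ (mem_boundary.2 ⟨huC, _, hi, hu⟩)
      have h2 := hlocal _ (hQ' (e j).2) (Finset.univ \ (C ∪ boundary G C) ∪ boundary G C)
        (by simp [hj.1, hj.2]) fun u hu => by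
          have huC : u ∉ C := fun huC => hj.2 (mem_boundary.2 ⟨hj.1, u, huC, hu.symm⟩)
          simp only [Finset.mem_union, Finset.mem_sdiff, Finset.mem_univ, huC]
          tauto
      rcases hv _ _ _ (isSep_boundary G C) with h | h <;> omega

/-- A graph of average degree at least `2 * davenport 𝒢 - 4` is zero-forcing. -/
theorem isZeroForcing_of_le_averageDegree {V : Type*} [Fintype V] {G : SimpleGraph V}
    [DecidableRel G.Adj] {𝒢 : Type*} [AddCommGroup 𝒢] (hD : 2 < davenport 𝒢)
    (h : 2 * (davenport 𝒢 : ℚ) - 4 ≤ averageDegree G) : IsZeroForcing G 𝒢 := by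
  classical
  rintro ⟨ℓ, hℓ⟩
  have hDQ : (2 : ℚ) < davenport 𝒢 := by exact_mod_cast hD
  rcases Nat.eq_zero_or_pos (Fintype.card V) with h0 | hpos
  · rw [averageDegree, h0, Nat.cast_zero, div_zero] at h
    linarith
  · obtain ⟨n, hn⟩ := Nat.exists_eq_succ_of_ne_zero hpos.ne'
    have hlt := adjPairs_lt_of_isZeroAvoiding hD n V G ℓ hn hℓ
    rw [averageDegree, le_div_iff₀ (by exact_mod_cast hpos), ← Nat.cast_sum,
      sum_degree_eq_adjPairs, hn] at h
    have hlt' : (adjPairs G : ℚ) < 2 * (davenport 𝒢 - 2 : ℕ) * ((n + 1 : ℕ) : ℚ) := by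
      exact_mod_cast hlt
    rw [Nat.cast_sub (by omega)] at hlt'
    push_cast at h hlt'
    nlinarith

/-! ### Brambles and tree-width duality -/

/-- A bramble: a finite family of pairwise touching connected sets. -/
structure IsBramble {V : Type*} (G : SimpleGraph V) (𝔅 : Finset (Finset V)) : Prop where
  conn : ∀ B ∈ 𝔅, IsConn G B
  touch : ∀ B ∈ 𝔅, ∀ B' ∈ 𝔅, ∃ a ∈ B, ∃ b ∈ B', a = b ∨ G.Adj a b

section Duality

variable {V : Type*} [Fintype V] [DecidableEq V] {G : SimpleGraph V}

/-- The step of tree-width duality for one component `C` of the complement of a minimum cover `X`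
of the bramble `𝔅`: a decomposition with a bag that covers `𝔅` and misses `C`, and all of whose
large bags fail to cover `insert C 𝔅`, restricts to a decomposition of `X ∪ C` all of whose large
bags fail to cover `𝔅`. -/
theorem exists_decomp_component {w : ℕ} {𝔅 : Finset (Finset V)} (h𝔅 : IsBramble G 𝔅)
    {X C : Finset V} (hXw : X.card ≤ w) (hX : ∀ B ∈ 𝔅, ¬ Disjoint B X)
    (hmin : ∀ Y : Finset V, (∀ B ∈ 𝔅, ¬ Disjoint B Y) → X.card ≤ Y.card)
    (hCX : Disjoint C X) (hCbd : boundary G C ⊆ X)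
    {ι : Type} (D : RootedDecomp G Finset.univ ι)
    (hD : ∀ s, w < (D.bag s).card → ∃ B ∈ insert C 𝔅, Disjoint B (D.bag s))
    (hrootC : Disjoint C (D.bag D.root)) (hroot : ∀ B ∈ 𝔅, ¬ Disjoint B (D.bag D.root)) :
    ∃ D' : RootedDecomp G (X ∪ C) ι, X ⊆ D'.bag D'.root ∧
      ∀ s, w < (D'.bag s).card → ∃ B ∈ 𝔅, Disjoint B (D'.bag s) := by
  refine ⟨D.restrict (Finset.subset_univ (X ∪ C)) Finset.subset_union_left,
    D.subset_restrict_root _ _, fun s hs => ?_⟩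
  change w < ((D.bag s ∩ (X ∪ C)) ∪ (X ∩ D.below s)).card at hs
  change ∃ B ∈ 𝔅, Disjoint B ((D.bag s ∩ (X ∪ C)) ∪ (X ∩ D.below s))
  -- exchanging the part of `X` below `s` for the rest of the bag gives another cover
  have hcov : ∀ B ∈ 𝔅, ¬ Disjoint B ((X \ D.below s) ∪ (D.bag s \ (X ∪ C))) := by
    intro B hB hdisj
    have hnot : ∀ v ∈ B, (v ∈ X → v ∈ D.below s) ∧ (v ∈ D.bag s → v ∈ X ∨ v ∈ C) := by
      intro v hv
      have := Finset.disjoint_left.1 hdisj hv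
      simp only [Finset.mem_union, Finset.mem_sdiff] at this
      tauto
    obtain ⟨x, hxB, hxX⟩ := Finset.not_disjoint_iff.1 (hX B hB)
    have hsub := (h𝔅.conn B hB).2 {v | v ∈ D.below s ∨ v ∈ C}
      ⟨x, hxB, Or.inl ((hnot x hxB).1 hxX)⟩ (by
        intro u huB hu v hvB huv
        rcases hu with hu | hu
        · by_cases hv : v ∈ D.below s
          · exact Or.inl hv
          · rcases (hnot v hvB).2 (D.mem_bag_of_adj_below hu (Finset.mem_univ v) huv hv) with h | h
            · exact Or.inl ((hnot v hvB).1 h)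
            · exact Or.inr h
        · by_cases hv : v ∈ C
          · exact Or.inr hv
          · exact Or.inl ((hnot v hvB).1 (hCbd (mem_boundary.2 ⟨hv, u, hu, huv⟩))))
    obtain ⟨r, hrB, hr⟩ := Finset.not_disjoint_iff.1 (hroot B hB)
    rcases hsub r hrB with h | h
    · exact D.notMem_below_of_mem_root hr h
    · exact Finset.disjoint_left.1 hrootC h hr
  have hle : ((D.bag s ∩ (X ∪ C)) ∪ (X ∩ D.below s)).card ≤ (D.bag s).card := by
    have h1 := hmin _ hcov
    have h2 := Finset.card_union_le (X \ D.below s) (D.bag s \ (X ∪ C))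
    have h3 := Finset.card_union_le (D.bag s ∩ (X ∪ C)) (X ∩ D.below s)
    have h4 : (X \ D.below s).card + (X ∩ D.below s).card = X.card :=
      Finset.card_sdiff_add_card_inter _ _
    have h5 : (D.bag s \ (X ∪ C)).card + (D.bag s ∩ (X ∪ C)).card = (D.bag s).card :=
      Finset.card_sdiff_add_card_inter _ _
    omega
  obtain ⟨B, hB, hBs⟩ := hD s (hs.trans_le hle)
  have hBC : B ≠ C := by
    rintro rfl
    refine absurd (Finset.card_le_card (t := X) fun v hv => ?_) (not_le.2 (hXw.trans_lt hs))
    have := fun h : v ∈ B => Finset.disjoint_left.1 hBs h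
    simp only [Finset.mem_union, Finset.mem_inter] at hv
    tauto
  have hB𝔅 : B ∈ 𝔅 := (Finset.mem_insert.1 hB).resolve_left hBC
  refine ⟨B, hB𝔅, Finset.disjoint_left.2 fun v hvB hv => ?_⟩
  have hvs := Finset.disjoint_left.1 hBs hvB
  have hvb : v ∈ D.below s := by
    simp only [Finset.mem_union, Finset.mem_inter] at hv
    tauto
  have hsub := (h𝔅.conn B hB𝔅).2 {v | v ∈ D.below s} ⟨v, hvB, hvb⟩ (by
    intro u _ hu z hz huz
    by_contra hzb
    exact Finset.disjoint_left.1 hBs hz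
      (D.mem_bag_of_adj_below hu (Finset.mem_univ z) huz hzb))
  obtain ⟨r, hrB, hr⟩ := Finset.not_disjoint_iff.1 (hroot B hB𝔅)
  exact D.notMem_below_of_mem_root hr (hsub r hrB)

/-- If `C` is a component of the complement of `X` that does not touch the member `B` of `𝔅`, then
`X` and `C ∪ boundary G C` are the bags of a decomposition as required. -/
theorem exists_decomp_of_not_touch {w : ℕ} {𝔅 : Finset (Finset V)}
    {X C B : Finset V} (hXw : X.card ≤ w) (hCX : Disjoint C X) (hCbd : boundary G C ⊆ X)
    (hB : B ∈ 𝔅) (hBC : ∀ a ∈ B, ∀ c ∈ C, ¬ (a = c ∨ G.Adj a c)) :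
    ∃ D' : RootedDecomp G (X ∪ C) (Unit ⊕ Unit), X ⊆ D'.bag D'.root ∧
      ∀ s, w < (D'.bag s).card → ∃ B ∈ 𝔅, Disjoint B (D'.bag s) := by
  have hK : X ∪ (C ∪ boundary G C) = X ∪ C := by
    ext v
    have := @hCbd v
    simp only [Finset.mem_union]
    tauto
  obtain ⟨D', hbag, hroot⟩ := RootedDecomp.exists_cast hK
    (RootedDecomp.glue (RootedDecomp.single G X) (RootedDecomp.single G (C ∪ boundary G C))
      Finset.inter_subset_left Finset.inter_subset_right (by
        intro x hx y hy hxy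
        rcases Finset.mem_union.1 hy with hy | hy
        · left
          refine Finset.mem_union_right _ (mem_boundary.2 ⟨?_, y, hy, hxy.symm⟩)
          exact Finset.disjoint_right.1 hCX hx
        · exact Or.inr (hCbd hy)))
  refine ⟨D', ?_, ?_⟩
  · rw [hbag, hroot]; exact subset_rfl
  · rw [hbag]
    rintro (s | s) hs
    · exact absurd hs (not_lt.2 hXw)
    · refine ⟨B, hB, Finset.disjoint_left.2 fun v hv hv' => ?_⟩
      rcases Finset.mem_union.1 (show v ∈ C ∪ boundary G C from hv') with h | h
      · exact hBC v hv v h (Or.inl rfl)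
      · obtain ⟨-, c, hc, hcv⟩ := mem_boundary.1 h
        exact hBC v hv c hc (Or.inr hcv.symm)

/-- Decompositions of the sets `X ∪ C`, for all components `C` of the complement of `X`, combine to
a decomposition of the whole graph. -/
theorem exists_decomp_of_components {w : ℕ} {𝔅 : Finset (Finset V)} {X : Finset V}
    (hXw : X.card ≤ w)
    (hcomp : ∀ C : Finset V, IsConn G C → Disjoint C X → boundary G C ⊆ X →
      ∃ (ι : Type) (_ : Fintype ι) (D : RootedDecomp G (X ∪ C) ι), X ⊆ D.bag D.root ∧
        ∀ s, w < (D.bag s).card → ∃ B ∈ 𝔅, Disjoint B (D.bag s)) :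
    ∃ (ι : Type) (_ : Fintype ι) (D : RootedDecomp G Finset.univ ι),
      ∀ s, w < (D.bag s).card → ∃ B ∈ 𝔅, Disjoint B (D.bag s) := by
  classical
  obtain ⟨K, hK, hmax⟩ := Finset.exists_max_image
    ((Finset.univ : Finset (Finset V)).filter fun K => X ⊆ K ∧ boundary G (K \ X) ⊆ X ∧
      ∃ (ι : Type) (_ : Fintype ι) (D : RootedDecomp G K ι), X ⊆ D.bag D.root ∧
        ∀ s, w < (D.bag s).card → ∃ B ∈ 𝔅, Disjoint B (D.bag s)) Finset.card
    ⟨X, by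
      simp only [Finset.mem_filter, Finset.mem_univ, true_and]
      refine ⟨subset_rfl, fun v hv => ?_, Unit, inferInstance, RootedDecomp.single G X,
        subset_rfl, fun s hs => absurd hs (not_lt.2 hXw)⟩
      obtain ⟨-, u, hu, -⟩ := mem_boundary.1 hv
      simp at hu⟩
  simp only [Finset.mem_filter, Finset.mem_univ, true_and] at hK hmax
  obtain ⟨hXK, hKbd, ι, hι, D, hDX, hD⟩ := hK
  by_cases hKu : K = Finset.univ
  · subst hKu
    exact ⟨ι, hι, D, hD⟩
  exfalso
  obtain ⟨v, hv⟩ : ∃ v, v ∉ K := by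
    by_contra h
    push Not at h
    exact hKu (Finset.eq_univ_iff_forall.2 h)
  obtain ⟨C, hCX, hvC, hC, hCbd⟩ := exists_isConn_boundary_disjoint (G := G)
    (Y := Finset.univ \ X) (v := v) (by simpa using fun h => hv (hXK h))
  have hCX' : Disjoint C X := Finset.disjoint_left.2 fun u hu huX => by
    simpa [huX] using hCX hu
  have hCbd' : boundary G C ⊆ X := fun u hu => by
    by_contra h
    exact Finset.disjoint_left.1 hCbd (by simpa using h) hu
  have hCK : Disjoint C K := by
    refine Finset.disjoint_left.2 fun u hu huK => ?_
    have hsub := hC.subset_of_disjoint_boundary (C := K \ X)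
      ⟨u, hu, Finset.mem_sdiff.2 ⟨huK, Finset.disjoint_left.1 hCX' hu⟩⟩
      (hCX'.mono_right hKbd)
    exact hv (Finset.mem_sdiff.1 (hsub hvC)).1
  obtain ⟨ι', hι', D', hDX', hD'⟩ := hcomp C hC hCX' hCbd'
  have hinter : K ∩ (X ∪ C) ⊆ X := by
    intro u hu
    have := fun h : u ∈ C => Finset.disjoint_left.1 hCK h
    simp only [Finset.mem_inter, Finset.mem_union] at hu
    tauto
  have hle := hmax (K ∪ (X ∪ C)) ⟨hXK.trans Finset.subset_union_left, ?_, _, inferInstance,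
    RootedDecomp.glue D D' (hinter.trans hDX) (hinter.trans hDX') ?_, hDX, ?_⟩
  · have hlt : K.card < (K ∪ (X ∪ C)).card := Finset.card_lt_card <|
      (Finset.ssubset_iff_of_subset Finset.subset_union_left).2 ⟨v, by simp [hvC], hv⟩
    omega
  · intro u hu
    obtain ⟨h1, z, hz, hzu⟩ := mem_boundary.1 hu
    by_contra huX
    simp only [Finset.mem_sdiff, Finset.mem_union, huX, not_false_eq_true, and_true, not_or] at h1 hz
    rcases hz.1 with h | h | h
    · exact huX (hKbd (mem_boundary.2 ⟨by simp [h1.1], z, by simp [h, hz.2], hzu⟩))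
    · exact hz.2 h
    · exact huX (hCbd' (mem_boundary.2 ⟨by tauto, z, h, hzu⟩))
  · intro x hx y hy hxy
    rcases Finset.mem_union.1 hy with hy | hy
    · exact Or.inr (hXK hy)
    · left
      by_cases hxC : x ∈ C
      · simp [hxC]
      · exact Finset.mem_union_left _ (hCbd' (mem_boundary.2 ⟨hxC, y, hy, hxy.symm⟩))
  · rintro (s | s) hs
    · exact hD s hs
    · exact hD' s hs

/-- Tree-width duality: if every bramble is covered by at most `w` vertices, then there is a
tree-decomposition with bags of at most `w` vertices. -/
theorem exists_decomp_of_bramble_cover {w : ℕ}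
    (h : ∀ 𝔅 : Finset (Finset V), IsBramble G 𝔅 →
      ∃ X : Finset V, X.card ≤ w ∧ ∀ B ∈ 𝔅, ¬ Disjoint B X) :
    ∃ (ι : Type) (_ : Fintype ι) (D : RootedDecomp G Finset.univ ι), ∀ s, (D.bag s).card ≤ w := by
  classical
  have key : ∀ m : ℕ, ∀ 𝔅 : Finset (Finset V), IsBramble G 𝔅 →
      Fintype.card (Finset V) - 𝔅.card = m →
      ∃ (ι : Type) (_ : Fintype ι) (D : RootedDecomp G Finset.univ ι),
        ∀ s, w < (D.bag s).card → ∃ B ∈ 𝔅, Disjoint B (D.bag s) := by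
    intro m
    induction m using Nat.strong_induction_on with
    | _ m ih =>
    intro 𝔅 h𝔅 hm
    by_contra hno
    obtain ⟨X₀, hX₀w, hX₀⟩ := h 𝔅 h𝔅
    obtain ⟨X, hX, hmin⟩ := Finset.exists_min_image
      ((Finset.univ : Finset (Finset V)).filter fun X => ∀ B ∈ 𝔅, ¬ Disjoint B X) Finset.card
      ⟨X₀, by simpa using hX₀⟩
    simp only [Finset.mem_filter, Finset.mem_univ, true_and] at hX hmin
    have hXw := (hmin X₀ hX₀).trans hX₀w
    refine hno (exists_decomp_of_components hXw fun C hC hCX hCbd => ?_)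
    by_cases htouch : ∀ B ∈ 𝔅, ∃ a ∈ B, ∃ c ∈ C, a = c ∨ G.Adj a c
    · have hC𝔅 : C ∉ 𝔅 := fun hC => hX C hC hCX
      have hbr : IsBramble G (insert C 𝔅) := by
        refine ⟨fun B hB => ?_, fun B hB B' hB' => ?_⟩
        · rcases Finset.mem_insert.1 hB with rfl | hB
          · exact hC
          · exact h𝔅.conn B hB
        · rcases Finset.mem_insert.1 hB with rfl | hB₁ <;>
            rcases Finset.mem_insert.1 hB' with rfl | hB₁'
          · obtain ⟨c, hc⟩ := hC.1
            exact ⟨c, hc, c, hc, Or.inl rfl⟩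
          · obtain ⟨a, ha, c, hc, hac⟩ := htouch B' hB₁'
            exact ⟨c, hc, a, ha, hac.imp Eq.symm SimpleGraph.Adj.symm⟩
          · exact htouch B hB₁
          · exact h𝔅.touch B hB₁ B' hB₁'
      have hcard : (insert C 𝔅).card = 𝔅.card + 1 := Finset.card_insert_of_notMem hC𝔅
      have hle : (insert C 𝔅).card ≤ Fintype.card (Finset V) := Finset.card_le_univ _
      obtain ⟨ι, hι, D, hD⟩ := ih _ (by omega) (insert C 𝔅) hbr rfl
      have hbad : ∃ s, w < (D.bag s).card ∧ ∀ B ∈ 𝔅, ¬ Disjoint B (D.bag s) := by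
        by_contra hcon
        push Not at hcon
        exact hno ⟨ι, hι, D, hcon⟩
      obtain ⟨s, hs, hs𝔅⟩ := hbad
      obtain ⟨D', hroot, hbag⟩ := D.exists_reroot s
      rw [← hbag] at hs hs𝔅 hD
      rw [← hroot] at hs hs𝔅
      have hCs : Disjoint C (D'.bag D'.root) := by
        obtain ⟨B, hB, hBs⟩ := hD _ hs
        rcases Finset.mem_insert.1 hB with rfl | hB
        · exact hBs
        · exact absurd hBs (hs𝔅 B hB)
      obtain ⟨D'', h1, h2⟩ := exists_decomp_component h𝔅 hXw hX hmin hCX hCbd D' hD hCs hs𝔅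
      exact ⟨ι, hι, D'', h1, h2⟩
    · push Not at htouch
      obtain ⟨B, hB, hBC⟩ := htouch
      obtain ⟨D', h1, h2⟩ := exists_decomp_of_not_touch (G := G) hXw hCX hCbd hB
        fun a ha c hc h => by
          have := hBC a ha c hc
          tauto
      exact ⟨_, inferInstance, D', h1, h2⟩
  obtain ⟨ι, hι, D, hD⟩ := key _ ∅ ⟨by simp, by simp⟩ rfl
  refine ⟨ι, hι, D, fun s => ?_⟩
  by_contra hs
  obtain ⟨B, hB, -⟩ := hD s (not_le.1 hs)
  simp at hB

end Duality

/-! ### Rooted decompositions bound the tree-width -/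

namespace RootedDecomp

variable {V : Type*} {G : SimpleGraph V}

/-- Transport of a decomposition along a bijection of the nodes. -/
def reindex {K : Finset V} {ι κ : Type} (D : RootedDecomp G K ι) (e : ι ≃ κ) :
    RootedDecomp G K κ where
  root := e D.root
  par t := e (D.par (e.symm t))
  depth t := D.depth (e.symm t)
  bag t := D.bag (e.symm t)
  top x := e (D.top x)
  par_root := by simp [D.par_root]
  depth_par t ht := by
    simpa using D.depth_par (e.symm t) (by rwa [Ne, Equiv.symm_apply_eq])
  bag_sub t := D.bag_sub _
  top_mem x hx := by simpa using D.top_mem x hx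
  up x t hx ht := by
    have := D.up x (e.symm t) hx (by rwa [Ne, Equiv.symm_apply_eq])
    simpa [Equiv.symm_apply_eq] using this
  edge x hx y hy hxy := by
    obtain ⟨s, hs⟩ := D.edge x hx y hy hxy
    exact ⟨e s, by simpa using hs⟩

/-- The undirected tree underlying a rooted decomposition. -/
def tree {K : Finset V} {ι : Type} (D : RootedDecomp G K ι) : SimpleGraph ι where
  Adj s t := s ≠ t ∧ (D.par s = t ∨ D.par t = s)
  symm := ⟨fun _ _ h => ⟨h.1.symm, h.2.symm⟩⟩
  loopless := ⟨fun _ h => h.1 rfl⟩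

theorem tree_adj_par {K : Finset V} {ι : Type} (D : RootedDecomp G K ι) {s : ι}
    (hs : s ≠ D.root) : D.tree.Adj s (D.par s) :=
  ⟨fun h => by have := D.depth_par s hs; rw [← h] at this; exact lt_irrefl _ this, Or.inl rfl⟩

theorem tree_isTree {K : Finset V} {ι : Type} [Finite ι] (D : RootedDecomp G K ι) :
    D.tree.IsTree := by
  have hreach : ∀ s, D.tree.Reachable s D.root := by
    intro s
    induction h : D.depth s using Nat.strong_induction_on generalizing s with
    | _ m ih =>
      by_cases hs : s = D.root
      · rw [hs]
      · exact (D.tree_adj_par hs).reachable.trans (ih _ (h ▸ D.depth_par s hs) _ rfl)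
  have hconn : D.tree.Connected := by
    have : Nonempty ι := ⟨D.root⟩
    exact SimpleGraph.Connected.mk fun s t => (hreach s).trans (hreach t).symm
  rw [SimpleGraph.isTree_iff_connected_and_card]
  refine ⟨hconn, le_antisymm ?_ hconn.card_vert_le_card_edgeSet_add_one⟩
  -- every edge joins a node other than the root to its parent
  have hsurj : Function.Surjective (fun s : {s : ι // s ≠ D.root} =>
      (⟨s(s.1, D.par s.1), D.tree_adj_par s.2⟩ : D.tree.edgeSet)) := by
    have hne : ∀ s t : ι, s ≠ t → D.par s = t → s ≠ D.root := by
      rintro s t hst h rfl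
      exact hst (D.par_root.symm.trans h)
    rintro ⟨z, hz⟩
    induction z using Sym2.ind with
    | _ s t =>
      obtain ⟨hst, h | h⟩ := (SimpleGraph.mem_edgeSet _).1 hz
      · exact ⟨⟨s, hne s t hst h⟩, by simp [h]⟩
      · exact ⟨⟨t, hne t s hst.symm h⟩, by simp [h, Sym2.eq_swap]⟩
  have h1 : Nat.card D.tree.edgeSet ≤ Nat.card {s : ι // s ≠ D.root} :=
    Nat.card_le_card_of_surjective _ hsurj
  have h2 : Nat.card {s : ι // s ≠ D.root} + 1 = Nat.card ι := by
    classical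
    have := Fintype.ofFinite ι
    have hpos : 0 < Fintype.card ι := Fintype.card_pos_iff.2 ⟨D.root⟩
    rw [Nat.card_eq_fintype_card, Nat.card_eq_fintype_card, Fintype.card_subtype_compl]
    simp only [Fintype.card_unique]
    omega
  omega

theorem isTreeDecomposition [Fintype V] {ι : Type} [Finite ι]
    (D : RootedDecomp G Finset.univ ι) : IsTreeDecomposition G D.tree D.bag where
  isTree := D.tree_isTree
  vertex_mem v := ⟨_, D.top_mem v (Finset.mem_univ v)⟩
  edge_mem u v h := D.edge u (Finset.mem_univ u) v (Finset.mem_univ v) h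
  connected v := by
    have hreach : ∀ s, ∀ hs : v ∈ D.bag s,
        (D.tree.induce {t | v ∈ D.bag t}).Reachable ⟨s, hs⟩
          ⟨D.top v, D.top_mem v (Finset.mem_univ v)⟩ := by
      intro s
      induction h : D.depth s using Nat.strong_induction_on generalizing s with
      | _ m ih =>
        intro hs
        by_cases hst : s = D.top v
        · subst hst; rfl
        · obtain ⟨h1, h2⟩ := D.up v s hs hst
          refine SimpleGraph.Reachable.trans (SimpleGraph.Adj.reachable ?_)
            (ih _ (h ▸ D.depth_par s h1) _ rfl h2)
          exact D.tree_adj_par h1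
    have : Nonempty {t | v ∈ D.bag t} := ⟨⟨D.top v, D.top_mem v (Finset.mem_univ v)⟩⟩
    exact SimpleGraph.Connected.mk fun s t => (hreach s.1 s.2).trans (hreach t.1 t.2).symm

theorem treewidth_le [Fintype V] {ι : Type} [Fintype ι] (D : RootedDecomp G Finset.univ ι)
    {w : ℕ} (h : ∀ s, (D.bag s).card ≤ w + 1) : treewidth G ≤ w :=
  Nat.sInf_le ⟨Fintype.card ι, _, _, (D.reindex (Fintype.equivFin ι)).isTreeDecomposition,
    fun _ => h _⟩

end RootedDecomp

/-! ### Paths through brambles -/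

/-- The list of vertices of a path. -/
def IsPathList {V : Type*} (G : SimpleGraph V) (l : List V) : Prop :=
  l.Nodup ∧ l.IsChain G.Adj

section Path

variable {V : Type*} {G : SimpleGraph V}

theorem IsPathList.infix {l l' : List V} (h : IsPathList G l) (h' : l' <:+: l) :
    IsPathList G l' :=
  ⟨h.1.sublist h'.sublist, h.2.infix h'⟩

theorem IsPathList.cons {u w : V} {l : List V} (h : IsPathList G l) (hu : l.head? = some u)
    (hw : w ∉ l) (huw : G.Adj u w) : IsPathList G (w :: l) := by
  refine ⟨List.nodup_cons.2 ⟨hw, h.1⟩, List.isChain_cons.2 ⟨fun y hy => ?_, h.2⟩⟩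
  rw [hu, Option.mem_some_iff] at hy
  exact hy ▸ huw.symm

theorem IsPathList.isConn [DecidableEq V] {l : List V} (h : IsPathList G l) (hl : l ≠ []) :
    IsConn G l.toFinset := by
  induction l with
  | nil => exact absurd rfl hl
  | cons v l ih =>
    rcases l with _ | ⟨w, l⟩
    · simpa using isConn_singleton v
    · have h1 := ih (h.infix (List.suffix_cons v _).isInfix) (by simp)
      have hvw : G.Adj v w := (List.isChain_cons.1 h.2).1 w (by simp)
      have h2 := (isConn_singleton (G := G) v).union h1
        ⟨v, by simp, w, by simp, Or.inr hvw⟩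
      rw [List.toFinset_cons, Finset.insert_eq]
      exact h2

/-- A path that meets the connected set `B` only in its head can be extended through `B` to a path
whose head is its only vertex in a given set that touches `B` and misses the path. -/
theorem IsPathList.exists_extend {v : V} {l : List V} (h : IsPathList G (v :: l))
    {B B' : Finset V} (hB : IsConn G B) (hvB : v ∈ B) (hlB : ∀ x ∈ l, x ∉ B)
    (hB' : ∀ x ∈ v :: l, x ∉ B') (htouch : ∃ a ∈ B, ∃ b ∈ B', a = b ∨ G.Adj a b) :
    ∃ w m, IsPathList G (w :: (m ++ v :: l)) ∧ w ∈ B' ∧ ∀ x ∈ m ++ v :: l, x ∉ B' := by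
  -- the vertices of `B` reachable by extensions inside `B` that avoid `B'`
  set R : Set V := {u | ∃ m, IsPathList G (m ++ v :: l) ∧ (m ++ v :: l).head? = some u ∧
    ∀ x ∈ m, x ∈ B ∧ x ∉ B'} with hR
  have hRv : v ∈ R := ⟨[], h, rfl, by simp⟩
  have hRB' : ∀ u ∈ R, u ∉ B' := by
    rintro u ⟨m, -, hu, hm⟩
    rcases m with _ | ⟨z, m⟩
    · simp only [List.nil_append, List.head?_cons, Option.some.injEq] at hu
      exact hB' u (by simp [hu])
    · simp only [List.cons_append, List.head?_cons, Option.some.injEq] at hu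
      exact hu ▸ (hm z (by simp)).2
  suffices hex : ∃ u ∈ R, ∃ w ∈ B', G.Adj u w by
    obtain ⟨u, ⟨m, hm, hu, hmB⟩, w, hw, huw⟩ := hex
    have hmiss : ∀ x ∈ m ++ v :: l, x ∉ B' := by
      intro x hx
      rcases List.mem_append.1 hx with hx | hx
      · exact (hmB x hx).2
      · exact hB' x hx
    exact ⟨w, m, hm.cons hu (fun h => hmiss w h hw) huw, hw, hmiss⟩
  by_contra hno
  push Not at hno
  have hall := hB.2 R ⟨v, hvB, hRv⟩ (by
    rintro u - hu w hwB huw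
    have hwB' : w ∉ B' := fun h => hno u hu w h huw
    obtain ⟨m, hm, hum, hmB⟩ := hu
    by_cases hwm : w ∈ m ++ v :: l
    · rcases List.mem_append.1 hwm with hwm | hwm
      · obtain ⟨m₁, m₂, rfl⟩ := List.append_of_mem hwm
        refine ⟨w :: m₂, hm.infix ?_, by simp, fun x hx => hmB x (by simp at hx ⊢; tauto)⟩
        rw [List.append_assoc]
        exact (List.suffix_append _ _).isInfix
      · rcases List.mem_cons.1 hwm with rfl | hwl
        · exact hRv
        · exact absurd hwB (hlB w hwl)
    · refine ⟨w :: m, hm.cons hum hwm huw, by simp, fun x hx => ?_⟩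
      rcases List.mem_cons.1 hx with rfl | hx
      · exact ⟨hwB, hwB'⟩
      · exact hmB x hx)
  obtain ⟨a, ha, b, hb, rfl | hab⟩ := htouch
  · exact hRB' a (hall a ha) hb
  · exact hno a (hall a ha) b hb hab

/-- Some path meets all members of a given bramble. -/
theorem IsBramble.exists_path [DecidableEq V] {𝔅 : Finset (Finset V)} (h𝔅 : IsBramble G 𝔅) :
    ∃ l, IsPathList G l ∧ ∀ B ∈ 𝔅, ¬ Disjoint B l.toFinset := by
  classical
  rcases 𝔅.eq_empty_or_nonempty with rfl | ⟨B₀, hB₀⟩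
  · exact ⟨[], ⟨by simp, by simp⟩, by simp⟩
  have key : ∀ m : ℕ, ∀ (v : V) (l : List V), IsPathList G (v :: l) →
      (∃ B ∈ 𝔅, v ∈ B ∧ ∀ x ∈ l, x ∉ B) →
      (𝔅.filter fun B => Disjoint B (v :: l).toFinset).card = m →
      ∃ l, IsPathList G l ∧ ∀ B ∈ 𝔅, ¬ Disjoint B l.toFinset := by
    intro m
    induction m using Nat.strong_induction_on with
    | _ m ih =>
    rintro v l hl ⟨B, hB, hvB, hlB⟩ hm
    by_cases hcov : ∀ B ∈ 𝔅, ¬ Disjoint B (v :: l).toFinset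
    · exact ⟨_, hl, hcov⟩
    push Not at hcov
    obtain ⟨B', hB', hdisj⟩ := hcov
    obtain ⟨w, p, hp, hw, hmiss⟩ := hl.exists_extend (h𝔅.conn B hB) hvB hlB
      (fun x hx hxB' => Finset.disjoint_left.1 hdisj hxB' (List.mem_toFinset.2 hx))
      (h𝔅.touch B hB B' hB')
    refine ih _ ?_ w _ hp ⟨B', hB', hw, hmiss⟩ rfl
    rw [← hm]
    refine Finset.card_lt_card ((Finset.ssubset_iff_of_subset fun D hD => ?_).2 ⟨B', ?_, ?_⟩)
    · rw [Finset.mem_filter] at hD ⊢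
      refine ⟨hD.1, hD.2.mono_right fun x hx => ?_⟩
      simp only [List.mem_toFinset] at hx ⊢
      exact List.mem_cons_of_mem _ (List.mem_append_right _ hx)
    · exact Finset.mem_filter.2 ⟨hB', hdisj⟩
    · rw [Finset.mem_filter, not_and]
      exact fun _ hd => Finset.disjoint_left.1 hd hw (by simp)
  obtain ⟨v, hv⟩ := (h𝔅.conn B₀ hB₀).1
  exact key _ v [] ⟨by simp, by simp⟩ ⟨B₀, hB₀, hv, by simp⟩ rfl

/-- A path meeting all members of a family that has no cover with fewer than `m * q` elements can
be cut into `m` connected pieces, each of which meets a subfamily without a cover with fewer than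
`q` elements. -/
theorem exists_segments [DecidableEq V] {q : ℕ} (hq : 0 < q) (m : ℕ) :
    ∀ (l : List V) (𝔅 : Finset (Finset V)), IsPathList G l →
      (∀ B ∈ 𝔅, ¬ Disjoint B l.toFinset) →
      (∀ X : Finset V, (∀ B ∈ 𝔅, ¬ Disjoint B X) → m * q ≤ X.card) →
      ∃ S : Fin m → Finset V, (∀ i, IsConn G (S i)) ∧ (∀ i, S i ⊆ l.toFinset) ∧
        (∀ i j, i ≠ j → Disjoint (S i) (S j)) ∧
        ∀ i, ∀ X : Finset V, X.card < q → ∃ B ∈ 𝔅, ¬ Disjoint B (S i) ∧ Disjoint B X := by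
  classical
  induction m with
  | zero =>
    intro l 𝔅 _ _ _
    exact ⟨Fin.elim0, fun i => i.elim0, fun i => i.elim0, fun i => i.elim0, fun i => i.elim0⟩
  | succ m ih =>
    intro l 𝔅 hl hcov hord
    -- the shortest initial piece that meets a subfamily of large order
    have hex : ∃ j, ∀ X : Finset V, X.card < q →
        ∃ B ∈ 𝔅, ¬ Disjoint B (l.take j).toFinset ∧ Disjoint B X := by
      refine ⟨l.length, fun X hX => ?_⟩
      by_contra hcon
      push Not at hcon
      rw [List.take_length] at hcon
      have := hord X fun B hB => hcon B hB (hcov B hB)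
      rw [Nat.succ_mul] at this
      omega
    have hj := Nat.find_spec hex
    have hjmin := fun i => Nat.find_min (m := i) hex
    set j := Nat.find hex
    have hj0 : j ≠ 0 := by
      intro h0
      obtain ⟨B, -, hB, -⟩ := hj ∅ (by simpa using hq)
      simp [h0] at hB
    obtain ⟨i, hi⟩ := Nat.exists_eq_succ_of_ne_zero hj0
    have hprev := hjmin i (by omega)
    push Not at hprev
    obtain ⟨X₀, hX₀, hX₀cov⟩ := hprev
    have hX₁ : ∃ X₁ : Finset V, X₁.card ≤ q ∧
        ∀ B ∈ 𝔅, ¬ Disjoint B (l.take j).toFinset → ¬ Disjoint B X₁ := by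
      refine ⟨X₀ ∪ (l[i]?).toFinset, (Finset.card_union_le _ _).trans ?_, fun B hB hBj => ?_⟩
      · have : (l[i]?).toFinset.card ≤ 1 := by
          rcases l[i]? with _ | z <;> simp
        omega
      · rw [hi, Nat.succ_eq_add_one, List.take_add_one, List.toFinset_append,
          Finset.disjoint_union_right, not_and_or] at hBj
        rw [Finset.disjoint_union_right, not_and_or]
        rcases hBj with hBj | hBj
        · exact Or.inl (hX₀cov B hB hBj)
        · right
          intro hd
          refine hBj (hd.mono_right fun z hz => ?_)
          simpa using hz
    obtain ⟨X₁, hX₁, hX₁cov⟩ := hX₁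
    obtain ⟨S, hS1, hS2, hS3, hS4⟩ := ih (l.drop j)
      (𝔅.filter fun B => Disjoint B (l.take j).toFinset)
      (hl.infix (List.drop_suffix j l).isInfix) (fun B hB hd => by
        obtain ⟨hB1, hB2⟩ := Finset.mem_filter.1 hB
        refine hcov B hB1 ?_
        rw [← List.take_append_drop j l, List.toFinset_append]
        exact Finset.disjoint_union_right.2 ⟨hB2, hd⟩)
      (fun X hX => by
        have h1 := hord (X ∪ X₁) fun B hB => by
          rw [Finset.disjoint_union_right, not_and_or]
          by_cases hBj : Disjoint B (l.take j).toFinset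
          · exact Or.inl (hX B (Finset.mem_filter.2 ⟨hB, hBj⟩))
          · exact Or.inr (hX₁cov B hB hBj)
        have h2 := Finset.card_union_le X X₁
        rw [Nat.succ_mul] at h1
        omega)
    have hdisj : Disjoint (l.take j).toFinset (l.drop j).toFinset := by
      rw [List.disjoint_toFinset_iff_disjoint]
      exact List.disjoint_take_drop hl.1 le_rfl
    refine ⟨Fin.cons (l.take j).toFinset S, ?_, ?_, ?_, ?_⟩
    · refine Fin.cases ?_ ?_
      · refine (hl.infix (List.take_prefix j l).isInfix).isConn fun hnil => ?_
        obtain ⟨B, -, hB, -⟩ := hj ∅ (by simpa using hq)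
        simp [hnil] at hB
      · simpa using hS1
    · refine Fin.cases ?_ ?_
      · intro x hx
        simp only [Fin.cons_zero, List.mem_toFinset] at hx ⊢
        exact List.mem_of_mem_take hx
      · intro i x hx
        have := hS2 i hx
        simp only [List.mem_toFinset] at this ⊢
        exact List.mem_of_mem_drop this
    · refine Fin.cases (Fin.cases (fun h => absurd rfl h) fun j' _ => ?_)
        (fun i' => Fin.cases (fun _ => ?_) fun j' hne => ?_)
      · simpa using hdisj.mono_right (hS2 j')
      · simpa using (hdisj.mono_right (hS2 i')).symm
      · simpa using hS3 i' j' fun h => hne (by rw [h])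
    · refine Fin.cases ?_ ?_
      · simpa using hj
      · intro i X hX
        obtain ⟨B, hB, h1, h2⟩ := hS4 i X hX
        exact ⟨B, (Finset.mem_filter.1 hB).1, by simpa using h1, h2⟩

end Path

/-! ### The tree-width bound -/

/-- In a zero-avoiding graph all paths have fewer than `|𝒢|` vertices: two partial label sums along
a longer path would agree. -/
theorem IsZeroAvoiding.length_lt {V 𝒢 : Type*} [DecidableEq V] [AddCommGroup 𝒢] [Finite 𝒢]
    {G : SimpleGraph V} {ℓ : V → 𝒢} (hℓ : IsZeroAvoiding G ℓ) {l : List V}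
    (hl : IsPathList G l) : l.length < Nat.card 𝒢 := by
  classical
  by_contra hlen
  push Not at hlen
  have := Fintype.ofFinite 𝒢
  rw [Nat.card_eq_fintype_card] at hlen
  have main : ∀ i j : Fin (l.length + 1), i < j →
      ((l.take i).map ℓ).sum = ((l.take j).map ℓ).sum → False := by
    intro i j hij heq
    have hinf : (l.take j).drop i <:+: l :=
      ((l.take j).drop_suffix i).isInfix.trans (l.take_prefix j).isInfix
    have hp := hl.infix hinf
    have hne : (l.take j).drop i ≠ [] := by
      intro h
      have h1 := congrArg List.length h
      have hj := j.2
      rw [List.length_drop, List.length_take, List.length_nil] at h1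
      have : (i : ℕ) < j := hij
      omega
    have hc := hp.isConn hne
    refine hℓ _ hc.1 hc.induce_connected ?_
    rw [List.sum_toFinset _ hp.1]
    have hsplit := congrArg (fun p => (p.map ℓ).sum) (List.take_append_drop (i : ℕ) (l.take j))
    simp only [List.map_append, List.sum_append, List.take_take] at hsplit
    rw [min_eq_left (le_of_lt (show (i : ℕ) < j from hij)), heq] at hsplit
    simpa using hsplit
  obtain ⟨i, j, hij, heq⟩ := Fintype.exists_ne_map_eq_of_card_lt
    (fun i : Fin (l.length + 1) => ((l.take i).map ℓ).sum) (by simpa using Nat.lt_succ_of_le hlen)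
  rcases lt_or_gt_of_ne hij with h | h
  · exact main i j h heq
  · exact main j i h heq.symm

/-- The brambles of a zero-avoiding graph have covers with fewer than `|𝒢|` vertices. -/
theorem IsZeroAvoiding.exists_cover_card {V 𝒢 : Type*} [DecidableEq V] [AddCommGroup 𝒢]
    [Finite 𝒢] {G : SimpleGraph V} {ℓ : V → 𝒢} (hℓ : IsZeroAvoiding G ℓ)
    {𝔅 : Finset (Finset V)} (h𝔅 : IsBramble G 𝔅) :
    ∃ X : Finset V, X.card < Nat.card 𝒢 ∧ ∀ B ∈ 𝔅, ¬ Disjoint B X := by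
  obtain ⟨l, hl, hcov⟩ := h𝔅.exists_path
  exact ⟨l.toFinset, (List.toFinset_card_le l).trans_lt (hℓ.length_lt hl), hcov⟩

section Treewidth

variable {V 𝒢 : Type*} [Fintype V] [DecidableEq V] [AddCommGroup 𝒢] {G : SimpleGraph V}
  {ℓ : V → 𝒢}

/-- The brambles of a zero-avoiding graph have covers with fewer than `D * (D - 1)` vertices, where
`D = davenport 𝒢`: otherwise a path through the bramble has `D` segments, no two of which are
separated by `D - 2` vertices. -/
theorem IsZeroAvoiding.exists_cover_davenport (hD : 2 < davenport 𝒢) (hℓ : IsZeroAvoiding G ℓ)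
    {𝔅 : Finset (Finset V)} (h𝔅 : IsBramble G 𝔅) :
    ∃ X : Finset V, X.card < davenport 𝒢 * (davenport 𝒢 - 1) ∧ ∀ B ∈ 𝔅, ¬ Disjoint B X := by
  by_contra hcon
  push Not at hcon
  obtain ⟨l, hl, hcov⟩ := h𝔅.exists_path
  obtain ⟨S, hS1, -, hS3, hS4⟩ := exists_segments (G := G) (q := davenport 𝒢 - 1) (by omega)
    (davenport 𝒢) l 𝔅 hl hcov fun X hX => by
      by_contra h
      obtain ⟨B, hB, hBX⟩ := hcon X (not_le.1 h)
      exact hX B hB hBX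
  refine not_isZeroAvoiding_of_inseparable (by omega) S hS1 hS3 (fun i j _ C hi hj => ?_) hℓ
  by_contra hlt
  obtain ⟨B, hB, hBi, hBC⟩ := hS4 i (boundary G C) (by omega)
  obtain ⟨B', hB', hBj, hBC'⟩ := hS4 j (boundary G C) (by omega)
  obtain ⟨x, hx, hxi⟩ := Finset.not_disjoint_iff.1 hBi
  obtain ⟨y, hy, hyj⟩ := Finset.not_disjoint_iff.1 hBj
  have hBsub := (h𝔅.conn B hB).subset_of_disjoint_boundary ⟨x, hx, hi hxi⟩ hBC
  have hBdisj : Disjoint B' C := by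
    refine Finset.disjoint_left.2 fun z hz hzC => ?_
    have := (h𝔅.conn B' hB').subset_of_disjoint_boundary ⟨z, hz, hzC⟩ hBC'
    exact Finset.disjoint_left.1 hj hyj (Finset.mem_union_left _ (this hy))
  obtain ⟨a, ha, b, hb, hab⟩ := h𝔅.touch B hB B' hB'
  have hbC := Finset.disjoint_left.1 hBdisj hb
  rcases hab with rfl | hab
  · exact hbC (hBsub ha)
  · exact Finset.disjoint_left.1 hBC' hb (mem_boundary.2 ⟨hbC, a, hBsub ha, hab⟩)

/-- If all brambles have covers with fewer than `w + 2` vertices, then the tree-width is at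
most `w`. -/
theorem treewidth_le_of_cover {w : ℕ} (h : ∀ 𝔅 : Finset (Finset V), IsBramble G 𝔅 →
    ∃ X : Finset V, X.card < w + 2 ∧ ∀ B ∈ 𝔅, ¬ Disjoint B X) : treewidth G ≤ w := by
  obtain ⟨ι, _, D, hD⟩ := exists_decomp_of_bramble_cover (w := w + 1) fun 𝔅 h𝔅 => by
    obtain ⟨X, h1, h2⟩ := h 𝔅 h𝔅
    exact ⟨X, by omega, h2⟩
  exact D.treewidth_le hD

end Treewidth

theorem two_le_card_of_davenport {𝒢 : Type*} [AddCommGroup 𝒢] [Finite 𝒢]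
    (hD : 1 < davenport 𝒢) : 2 ≤ Nat.card 𝒢 := by
  by_contra h
  have hsub : Subsingleton 𝒢 := by
    rw [← Finite.card_le_one_iff_subsingleton]; omega
  have : davenport 𝒢 ≤ 1 := Nat.sInf_le fun f => ⟨{0}, by simp, Subsingleton.elim _ _⟩
  omega

/-- A graph of large tree-width is zero-forcing. -/
theorem isZeroForcing_of_le_treewidth {V : Type*} [Fintype V] {G : SimpleGraph V}
    {𝒢 : Type*} [AddCommGroup 𝒢] [Finite 𝒢] (hD : 2 < davenport 𝒢)
    (h : min ((Nat.card 𝒢 : ℤ) - 1) ((davenport 𝒢 : ℤ) ^ 2 - (davenport 𝒢 : ℤ) - 1) ≤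
      (treewidth G : ℤ)) : IsZeroForcing G 𝒢 := by
  classical
  rintro ⟨ℓ, hℓ⟩
  rcases min_le_iff.1 h with h | h
  · obtain ⟨w, hw⟩ := Nat.exists_eq_add_of_le (two_le_card_of_davenport (𝒢 := 𝒢) (by omega))
    have := treewidth_le_of_cover (w := w) fun 𝔅 h𝔅 => by
      have := hℓ.exists_cover_card h𝔅
      rwa [hw, add_comm] at this
    omega
  · obtain ⟨d, hd⟩ := Nat.exists_eq_add_of_le (show 2 ≤ davenport 𝒢 by omega)
    have := treewidth_le_of_cover (w := d * d + 3 * d) fun 𝔅 h𝔅 => by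
      have := hℓ.exists_cover_davenport hD h𝔅
      have e : davenport 𝒢 * (davenport 𝒢 - 1) = d * d + 3 * d + 2 := by
        rw [hd, show 2 + d - 1 = d + 1 by omega]; ring
      rwa [e] at this
    have h2 : (treewidth G : ℤ) ≤ d * d + 3 * d := by exact_mod_cast this
    rw [hd] at h
    push_cast at h
    nlinarith

end ZeroForcing

theorem mainTheorem6 {V : Type*} [Fintype V] (G : SimpleGraph V) [DecidableRel G.Adj]
    (𝒢 : Type*) [AddCommGroup 𝒢] [Finite 𝒢] (hD : 2 < ZeroForcing.davenport 𝒢) :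
    (2 * (ZeroForcing.davenport 𝒢 : ℚ) - 4 ≤ ZeroForcing.averageDegree G →
      ZeroForcing.IsZeroForcing G 𝒢) ∧
    (min ((Nat.card 𝒢 : ℤ) - 1)
        ((ZeroForcing.davenport 𝒢 : ℤ) ^ 2 - (ZeroForcing.davenport 𝒢 : ℤ) - 1) ≤
        (ZeroForcing.treewidth G : ℤ) →
      ZeroForcing.IsZeroForcing G 𝒢) :=
  ⟨ZeroForcing.isZeroForcing_of_le_averageDegree hD,
    ZeroForcing.isZeroForcing_of_le_treewidth hD⟩
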